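/- Let $K$ be a field, $R=K[x_1,\dots,x_n]$, $[X]$ the monoid of power-products and $F=(f_1,\dots,f_m)$ any finite sequence in $R$ (zero or repeated entries are allowed). Let $\bar{\cdot}:R^m\to R$ be the $R$-linear map with $\bar{\mathbf e}_i=f_i$. A term is a product $t\,\mathbf e_i$ with $t\in[X]$; for terms, $u\mid v$ means $v=t\,u$ for some $t\in[X]$. Let $\preceq$ be an admissible (linear) order on $[X]$, with leading power-products $\mathrm{lp}$ and leading coefficients $\mathrm{lc}$, and let $\preceq_t$ be a linear order on the terms with $u\preceq_t v\Rightarrow t\,u\preceq_t t\,v$ for all $t\in[X]$, and $s\preceq t\Rightarrow s\,\mathbf e_i\preceq_t t\,\mathbf e_i$. The signature $\mathfrak s(a)$ of $a\in R^m\setminus\{0\}$ is its $\preceq_t$-largest term; $\mathfrak s(0)$ is undefined (it contributes no element to a set of signatures). *$\mathfrak s$-reduction.* For $G\subseteq R^m$, $a$ $\mathfrak s$-reduces to $b$ modulo $G$ in one step if there are $g\in G$, $t\in[X]$ with $\bar g\ne0$, $t\,\mathrm{lp}(\bar g)\in\mathrm{supp}(\bar a)$, $t\,\mathfrak s(g)\preceq_t\mathfrak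 s(a)$ and $b=a-\frac{c}{\mathrm{lc}(\bar g)}\,t\,g$, where $c$ is the coefficient of $t\,\mathrm{lp}(\bar g)$ in $\bar a$. The step is regular if $t\,\mathfrak s(g)\prec_t\mathfrak s(a)$, and top if $t\,\mathrm{lp}(\bar g)=\mathrm{lp}(\bar a)$. The set $G$ is a signature Gröbner basis in a term $u$ if every $a$ with $\mathfrak s(a)=u$ can be $\mathfrak s$-reduced modulo $G$ in finitely many steps to some $b$ with $\bar b=0$; it is one up to $u$ if it is one in all $v\prec_t u$, and a signature Gröbner basis if it is one in all terms. A syzygy signature is a term $\mathfrak s(a)$ with $a\ne0$, $\bar a=0$. *Rewrite orders and rewrite bases.* Sig-poly-pairs are the pairs $(\mathfrak s(a),\bar a)$ with $a\neq0$. A rewrite order $\trianglelefteq$ is a reflexive, transitive, total relation on sig-poly-pairs such that (i) $(u,p)\trianglelefteq(v,q)$ and $(v,q)\trianglelefteq(u,p)$ imply $u=v$; (ii) if $a,b\in G\setminus\{0\}$, $\mathfrak s(a)\mid\mathfrak s(b)$, $G$ is a signature Gröbner basis up to $\mathfrak s(b)$ and $b$ is regular top $\mathfrak s$-irreducible modulo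 $G$, then $(\mathfrak s(a),\bar a)\trianglelefteq(\mathfrak s(b),\bar b)$. An element $a\in G\setminus\{0\}$ with $\mathfrak s(a)\mid u$ is a canonical rewriter in $u$ w.r.t. $G$ if $(\mathfrak s(g),\bar g)\trianglelefteq(\mathfrak s(a),\bar a)$ for all $g\in G\setminus\{0\}$ with $\mathfrak s(g)\mid u$. The set $G$ is a rewrite basis if for every term $u$, either $u$ is a syzygy signature, or there is a canonical rewriter $g$ in $u$ w.r.t. $G$ such that $\frac{u}{\mathfrak s(g)}\,g$ is regular top $\mathfrak s$-irreducible modulo $G$. *S-pairs.* For $\bar a,\bar b\ne0$ and $t=\mathrm{lcm}(\mathrm{lp}(\bar a),\mathrm{lp}(\bar b))$, put $\mathrm{spair}(a,b)=\frac{t}{\mathrm{lc}(\bar a)\,\mathrm{lp}(\bar a)}a-\frac{t}{\mathrm{lc}(\bar b)\,\mathrm{lp}(\bar b)}b$, $u_a=\frac{t}{\mathrm{lp}(\bar a)}\mathfrak s(a)$, $u_b=\frac{t}{\mathrm{lp}(\bar b)}\mathfrak s(b)$; the S-pair is regular if $u_a\ne u_b$. *Algorithm RB.* Start with $G=\emptyset$,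 $S=\{\mathfrak s(f_j\mathbf e_i-f_i\mathbf e_j): i<j\}$, $P=\{\mathbf e_1,\dots,\mathbf e_m\}$; S-pairs in $P$ are stored together with the two elements they come from. While $P\ne\emptyset$: remove from $P$ some element $a$ of $\preceq_t$-minimal signature; if $a=\mathbf e_i$, add to $S$ all $\mathfrak s(f_i\,g-\bar g\,\mathbf e_i)$, $g\in G$. If $\mathrm{sigCrit}(G,S,a)$ holds, continue with the next pass. Otherwise let $b$ be a result of exhaustively regular $\mathfrak s$-reducing $a$ modulo $G$. If $\bar b=0$, add $\mathfrak s(b)$ to $S$; otherwise add to $P$ all regular S-pairs $\mathrm{spair}(g,b)$ with $g\in G$, and then add $b$ to $G$. When $P=\emptyset$, return $G$. Here $\mathrm{sigCrit}(G,S,\mathbf e_i)$ holds iff some $s\in S$ divides $\mathbf e_i$, and $\mathrm{sigCrit}(G,S,\mathrm{spair}(a,b))$ holds iff some $s\in S$ divides $u_a$ or $u_b$, or $a$ is not a canonical rewriter in $u_a$ w.r.t. $G$, or $b$ is not a canonical rewriter in $u_b$ w.r.t. $G$. **Theorem (total correctness).** For every $F$, $\preceq$, $\preceq_t$ and every rewrite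 order $\trianglelefteq$ as above, and for all possible choices of the minimal elements $a$ and of the reduction results $b$, Algorithm RB terminates: no execution is infinite, and whenever $P\neq\emptyset$ a next pass can be carried out. Every returned $G$ is finite, is a rewrite basis, is a signature Gröbner basis, and satisfies $\langle\{\bar g: g\in G\}\rangle=\langle f_1,\dots,f_m\rangle$. -/

import Mathlib

open scoped MonomialOrder

namespace SigGB

/-- A term `t e_i` of the free module `R^m` over `R = K[x_1, …, x_n]`: a power-product, given by
its exponent vector, and a component. -/
@[ext]
structure Term (n m : ℕ) where
  pp : Fin n →₀ ℕ
  comp : Fin m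

/-- Multiplication of a term by a power-product: `t (s e_i) = (t s) e_i`. -/
noncomputable def Term.shift {n m : ℕ} (t : Fin n →₀ ℕ) (u : Term n m) : Term n m := ⟨t + u.pp, u.comp⟩

/-- The linear order on terms is a module term order compatible with the admissible order `ord`:
it is monotone under multiplication by power-products and extends `ord` in each component. -/
structure IsCompatibleTermOrder {n m : ℕ} [LinearOrder (Term n m)]
    (ord : MonomialOrder (Fin n)) : Prop where
  shift_le_shift : ∀ (t : Fin n →₀ ℕ) (u v : Term n m), u ≤ v → u.shift t ≤ v.shift t
  compatible : ∀ (s t : Fin n →₀ ℕ) (i : Fin m), s ≼[ord] t → (⟨s, i⟩ : Term n m) ≤ ⟨t, i⟩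

/-- The free module `R^m` over `R = K[x_1, …, x_n]`. -/
abbrev FreeMod (K : Type*) [Field K] (n m : ℕ) : Type _ := Fin m → MvPolynomial (Fin n) K

section Basic

variable {K : Type*} [Field K] {n m : ℕ}

open Classical in
/-- The support of a module element: the terms with a nonzero coefficient. -/
noncomputable def supp (a : FreeMod K n m) : Finset (Term n m) :=
  Finset.univ.biUnion fun i => (a i).support.image fun t => ⟨t, i⟩

theorem mem_supp (a : FreeMod K n m) (u : Term n m) :
    u ∈ supp a ↔ (a u.comp).coeff u.pp ≠ 0 := by
  classical
  simp only [supp, Finset.mem_biUnion, Finset.mem_univ, true_and, Finset.mem_image,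
    MvPolynomial.mem_support_iff]
  constructor
  · rintro ⟨i, t, h, rfl⟩
    exact h
  · intro h
    exact ⟨u.comp, u.pp, h, rfl⟩

theorem supp_nonempty_iff (a : FreeMod K n m) : (supp a).Nonempty ↔ a ≠ 0 := by
  constructor
  · rintro ⟨u, hu⟩ rfl
    simp [mem_supp] at hu
  · intro h
    obtain ⟨i, hi⟩ := Function.ne_iff.mp h
    obtain ⟨t, ht⟩ := MvPolynomial.ne_zero_iff.mp hi
    exact ⟨⟨t, i⟩, (mem_supp a ⟨t, i⟩).mpr ht⟩

/-- The homomorphism `a ↦ ā` from `R^m` to `R` with `e_i ↦ f_i`. -/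
noncomputable def bar (f : Fin m → MvPolynomial (Fin n) K) :
    FreeMod K n m →ₗ[MvPolynomial (Fin n) K] MvPolynomial (Fin n) K :=
  Fintype.linearCombination (MvPolynomial (Fin n) K) f

/-- The canonical basis vector `e_i`. -/
noncomputable def basisVec (K : Type*) [Field K] {n m : ℕ} (i : Fin m) : FreeMod K n m :=
  Pi.single i 1

end Basic

section Signature

variable {K : Type*} [Field K] {n m : ℕ} [LinearOrder (Term n m)]

/-- The signature (leading term) of a module element; `⊥` (undefined) exactly for `a = 0`. -/
noncomputable def sig (a : FreeMod K n m) : WithBot (Term n m) := (supp a).max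

theorem sig_ne_bot {a : FreeMod K n m} (ha : a ≠ 0) : sig a ≠ ⊥ := by
  intro h
  exact (Finset.nonempty_iff_ne_empty.mp ((supp_nonempty_iff a).mpr ha))
    (Finset.max_eq_bot.mp h)

/-- `t u` for a power-product `t` and a possibly undefined term `u`. -/
noncomputable def shiftBot (t : Fin n →₀ ℕ) (u : WithBot (Term n m)) : WithBot (Term n m) :=
  u.map (Term.shift t)

/-- Divisibility `u ∣ v` of terms: `v = t u` for some power-product `t`. -/
def TermDvd (u v : WithBot (Term n m)) : Prop := ∃ t : Fin n →₀ ℕ, v = shiftBot t u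

variable (ord : MonomialOrder (Fin n)) (f : Fin m → MvPolynomial (Fin n) K)

/-- `a` s-reduces to `b` modulo `G`, where `t s(g)` and `s(a)` are related by `r₁`, and
`t lp(ḡ)` and `lp(ā)` by `r₂`. -/
def SigRed (r₁ : WithBot (Term n m) → WithBot (Term n m) → Prop)
    (r₂ : (Fin n →₀ ℕ) → (Fin n →₀ ℕ) → Prop)
    (G : Set (FreeMod K n m)) (a b : FreeMod K n m) : Prop :=
  ∃ g ∈ G, ∃ t : Fin n →₀ ℕ,
    bar f g ≠ 0 ∧
    t + ord.degree (bar f g) ∈ (bar f a).support ∧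
    b = a - MvPolynomial.monomial t
      ((bar f a).coeff (t + ord.degree (bar f g)) / ord.leadingCoeff (bar f g)) • g ∧
    r₁ (shiftBot t (sig g)) (sig a) ∧
    r₂ (t + ord.degree (bar f g)) (ord.degree (bar f a))

/-- General s-reduction. -/
def SRed (G : Set (FreeMod K n m)) (a b : FreeMod K n m) : Prop :=
  SigRed ord f (· ≤ ·) (fun s t => s ≼[ord] t) G a b

/-- Regular s-reduction. -/
def RegSRed (G : Set (FreeMod K n m)) (a b : FreeMod K n m) : Prop :=
  SigRed ord f (· < ·) (fun s t => s ≼[ord] t) G a b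

/-- Regular top s-reduction. -/
def RegTopSRed (G : Set (FreeMod K n m)) (a b : FreeMod K n m) : Prop :=
  SigRed ord f (· < ·) (· = ·) G a b

/-- `a` is regular top s-irreducible modulo `G`. -/
def RegTopIrred (G : Set (FreeMod K n m)) (a : FreeMod K n m) : Prop :=
  ¬ ∃ b, RegTopSRed ord f G a b

/-- `b` is a result of regular s-reducing `a` modulo `G` as far as possible. -/
def IsRegNormalForm (G : Set (FreeMod K n m)) (a b : FreeMod K n m) : Prop :=
  Relation.ReflTransGen (RegSRed ord f G) a b ∧ ¬ ∃ c, RegSRed ord f G b c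

/-- `a` s-reduces to zero (that is, to a syzygy) modulo `G`. -/
def SRedZero (G : Set (FreeMod K n m)) (a : FreeMod K n m) : Prop :=
  ∃ b, Relation.ReflTransGen (SRed ord f G) a b ∧ bar f b = 0

/-- `G` is a signature Gröbner basis in the term `u`. -/
def IsSigGBIn (G : Set (FreeMod K n m)) (u : Term n m) : Prop :=
  ∀ a : FreeMod K n m, sig a = u → SRedZero ord f G a

/-- `G` is a signature Gröbner basis up to `u`. -/
def IsSigGBUpTo (G : Set (FreeMod K n m)) (u : WithBot (Term n m)) : Prop :=
  ∀ v : Term n m, v < u → IsSigGBIn ord f G v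

/-- `G` is a signature Gröbner basis. -/
def IsSigGB (G : Set (FreeMod K n m)) : Prop := ∀ u : Term n m, IsSigGBIn ord f G u

/-- `u` is a syzygy signature: the signature of some (nonzero) syzygy of `f`. -/
def IsSyzSig (u : Term n m) : Prop := ∃ a : FreeMod K n m, a ≠ 0 ∧ sig a = u ∧ bar f a = 0

/-- Sig-poly-pairs: pairs `(s(a), ā)` with `a ≠ 0`. -/
abbrev SigPolyPair : Type _ :=
  {p : Term n m × MvPolynomial (Fin n) K //
    ∃ a : FreeMod K n m, a ≠ 0 ∧ sig a = p.1 ∧ bar f a = p.2}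

/-- The sig-poly-pair `(s(a), ā)` of a nonzero module element `a`. -/
noncomputable def sppOf (a : FreeMod K n m) (ha : a ≠ 0) : SigPolyPair f :=
  ⟨((sig a).unbot (sig_ne_bot ha), bar f a), a, ha, (WithBot.coe_unbot _ _).symm, rfl⟩

/-- Rewrite orders. -/
structure IsRewriteOrder (rw : SigPolyPair f → SigPolyPair f → Prop) : Prop where
  refl : ∀ p, rw p p
  trans : ∀ p q r, rw p q → rw q r → rw p r
  total : ∀ p q, rw p q ∨ rw q p
  sig_eq : ∀ p q, rw p q → rw q p → p.1.1 = q.1.1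
  dvd : ∀ (G : Set (FreeMod K n m)) (a b : FreeMod K n m) (ha : a ≠ 0) (hb : b ≠ 0),
    IsSigGBUpTo ord f G (sig b) → a ∈ G → b ∈ G → TermDvd (sig a) (sig b) →
    RegTopIrred ord f G b → rw (sppOf f a ha) (sppOf f b hb)

/-- `a` is a canonical rewriter in signature `u` with respect to `G`. -/
def IsCanonicalRewriter (rw : SigPolyPair f → SigPolyPair f → Prop)
    (G : Set (FreeMod K n m)) (u : WithBot (Term n m)) (a : FreeMod K n m) : Prop :=
  ∃ ha : a ≠ 0, a ∈ G ∧ TermDvd (sig a) u ∧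
    ∀ g ∈ G, ∀ hg : g ≠ 0, TermDvd (sig g) u → rw (sppOf f g hg) (sppOf f a ha)

/-- `G` is a rewrite basis in the term `u`; below, `t` is the quotient `u / s(g)`. -/
def IsRewriteBasisIn (rw : SigPolyPair f → SigPolyPair f → Prop)
    (G : Set (FreeMod K n m)) (u : Term n m) : Prop :=
  IsSyzSig f u ∨
    ∃ g, IsCanonicalRewriter f rw G u g ∧
      ∃ t : Fin n →₀ ℕ, u = shiftBot t (sig g) ∧
        RegTopIrred ord f G (MvPolynomial.monomial t (1 : K) • g)

/-- `G` is a rewrite basis. -/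
def IsRewriteBasis (rw : SigPolyPair f → SigPolyPair f → Prop)
    (G : Set (FreeMod K n m)) : Prop :=
  ∀ u : Term n m, IsRewriteBasisIn ord f rw G u

/-- For `t = lcm(lp(ā), lp(b̄))`, the cofactor `t / lp(ā)`. -/
noncomputable def cofactor (a b : FreeMod K n m) : Fin n →₀ ℕ :=
  (ord.degree (bar f a) ⊔ ord.degree (bar f b)) - ord.degree (bar f a)

/-- The S-pair of `a` and `b`. -/
noncomputable def spair (a b : FreeMod K n m) : FreeMod K n m :=
  MvPolynomial.monomial (cofactor ord f a b) (1 / ord.leadingCoeff (bar f a)) • a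
    - MvPolynomial.monomial (cofactor ord f b a) (1 / ord.leadingCoeff (bar f b)) • b

/-- For `t = lcm(lp(ā), lp(b̄))`, the term `(t / lp(ā)) s(a)`. -/
noncomputable def pairSig (a b : FreeMod K n m) : WithBot (Term n m) :=
  shiftBot (cofactor ord f a b) (sig a)

/-- `a` and `b` give rise to a regular S-pair. -/
def IsRegularSpair (a b : FreeMod K n m) : Prop :=
  bar f a ≠ 0 ∧ bar f b ≠ 0 ∧ pairSig ord f a b ≠ pairSig ord f b a

end Signature

section Algorithm

/-- The entries of the set `P` in the algorithm: S-pairs, stored through the two elements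
they come from, and canonical basis vectors, stored through their index. -/
inductive CritElem (K : Type*) [Field K] (n m : ℕ) where
  | pair (a b : FreeMod K n m)
  | basis (i : Fin m)

/-- The values of the program variables `G`, `S`, `P`. -/
structure RBState (K : Type*) [Field K] (n m : ℕ) where
  G : Set (FreeMod K n m)
  S : Set (Term n m)
  P : Set (CritElem K n m)

variable {K : Type*} [Field K] {n m : ℕ} [LinearOrder (Term n m)]
variable (ord : MonomialOrder (Fin n)) (f : Fin m → MvPolynomial (Fin n) K)
variable (rw : SigPolyPair f → SigPolyPair f → Prop)

/-- The module element that an entry of `P` stands for. -/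
noncomputable def CritElem.toMod : CritElem K n m → FreeMod K n m
  | .pair a b => spair ord f a b
  | .basis i => basisVec K i

/-- The initial values: `G` is empty, `S` consists of the signatures of the (nonzero) Koszul
syzygies `f_j e_i - f_i e_j`, and `P` of all canonical basis vectors. -/
def initState : RBState K n m where
  G := ∅
  S := {u : Term n m | ∃ i j : Fin m, i < j ∧
    sig (f j • basisVec K i - f i • basisVec K j : FreeMod K n m) = (u : WithBot (Term n m))}
  P := Set.range CritElem.basis

/-- The signatures added to `S` when `p` is processed: those of the (nonzero) syzygies
`f_i g - ḡ e_i` with `g ∈ G` if `p` is `e_i`, and none otherwise. -/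
def newSyzSigs (G : Set (FreeMod K n m)) : CritElem K n m → Set (Term n m)
  | .pair _ _ => ∅
  | .basis i =>
      {u : Term n m | ∃ g ∈ G, sig (f i • g - bar f g • basisVec K i) = (u : WithBot (Term n m))}

/-- The criterion `sigCrit`. -/
def SigCrit (G : Set (FreeMod K n m)) (S : Set (Term n m)) : CritElem K n m → Prop
  | .pair a b =>
      (∃ s ∈ S, TermDvd s (pairSig ord f a b)) ∨
        ¬ IsCanonicalRewriter f rw G (pairSig ord f a b) a ∨
        (∃ s ∈ S, TermDvd s (pairSig ord f b a)) ∨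
        ¬ IsCanonicalRewriter f rw G (pairSig ord f b a) b
  | .basis i => ∃ s ∈ S, TermDvd s (sig (basisVec K i : FreeMod K n m))

/-- `p` is an element of `P` with minimal signature. -/
def IsMinSigIn (P : Set (CritElem K n m)) (p : CritElem K n m) : Prop :=
  p ∈ P ∧ ∀ q ∈ P, sig (p.toMod ord f) ≤ sig (q.toMod ord f)

/-- One pass through the body of the `while` loop of the algorithm. The choice of an element
of minimal signature in `P` and the choice of a regular s-normal form are nondeterministic. -/
inductive RBStep : RBState K n m → RBState K n m → Prop
  | skip (s : RBState K n m) (p : CritElem K n m)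
      (hp : IsMinSigIn ord f s.P p)
      (hc : SigCrit ord f rw s.G (s.S ∪ newSyzSigs f s.G p) p) :
      RBStep s ⟨s.G, s.S ∪ newSyzSigs f s.G p, s.P \ {p}⟩
  | zero (s : RBState K n m) (p : CritElem K n m) (b : FreeMod K n m)
      (hp : IsMinSigIn ord f s.P p)
      (hc : ¬ SigCrit ord f rw s.G (s.S ∪ newSyzSigs f s.G p) p)
      (hb : IsRegNormalForm ord f s.G (p.toMod ord f) b)
      (h0 : bar f b = 0) :
      RBStep s ⟨s.G, s.S ∪ newSyzSigs f s.G p ∪ {u | sig b = u}, s.P \ {p}⟩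
  | add (s : RBState K n m) (p : CritElem K n m) (b : FreeMod K n m)
      (hp : IsMinSigIn ord f s.P p)
      (hc : ¬ SigCrit ord f rw s.G (s.S ∪ newSyzSigs f s.G p) p)
      (hb : IsRegNormalForm ord f s.G (p.toMod ord f) b)
      (h0 : bar f b ≠ 0) :
      RBStep s ⟨s.G ∪ {b}, s.S ∪ newSyzSigs f s.G p,
        s.P \ {p} ∪ {q | ∃ g ∈ s.G, IsRegularSpair ord f g b ∧ q = .pair g b}⟩

/-- The states that occur in some execution of the algorithm on input `f`. -/
def Reachable (s : RBState K n m) : Prop :=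
  Relation.ReflTransGen (RBStep ord f rw) (initState f) s

end Algorithm

end SigGB

/-!
# Total correctness of the signature-based rewrite basis algorithm

*Minimality.* Let `G` be a signature Gröbner basis up to a term `u`. If `a` and `b` both have
signature `u`, then some `a - c b` has smaller signature, hence s-reduces to zero. If `a` is regular
top s-irreducible, the leading power-product of `ā` must therefore be at most that of `b̄`
(`RegTopIrred.degree_le`). So the leading power-product of an irreducible element is determined by
its signature, and its image vanishes at syzygy signatures. A first consequence is that a rewrite
basis is a signature Gröbner basis (`IsRewriteBasisIn.isSigGBIn`).

*Correctness.* The loop invariant `RBInvariant` says that every basis vector and every regular S-pair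
of elements of `G` is still in `P` or is `Handled`. It implies that `G` is a rewrite basis in every
term `u` below the signatures of `P` (`RBInvariant.isRewriteBasisIn`): let `g` be canonical in `u`
and suppose its multiple `t g` of signature `u` is regular top s-reducible. By minimality, a reducer
of least signature `v` may be replaced by a multiple of the canonical rewriter `h` in `v`. The S-pair
of `g` and `h` has signature dividing `u`, so it is no longer in `P`; but neither of the criteria
applies to it, and an element `b ∈ G` with its signature is excluded by condition (ii) on rewrite
orders, which would force `g` to have the same signature as `b` and to be reducible itself
(`IsCanonicalRewriter.sig_ne`). The same argument shows that elements of `G` have distinct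
signatures, which keeps the invariant alive when an element is added (`RBInvariant.add`).

*Termination.* Consider all elements that an execution ever adds to `G`. If the signature of `b` is
`t` times that of `g` and the leading power-product of `b̄` is `t'` times that of `ḡ`, then `t = t'`:
minimality excludes that `t'` is larger, irreducibility of `b` that it is smaller
(`RBInvariant.shift_eq`). By Dickson's lemma, only finitely many ratios of signature and leading
power-product occur. The two parents of an element have smaller ratios than the element, and they
determine its signature, so there are only finitely many elements of each ratio
(`finite_of_parents`). Once `G` stays the same, every pass removes an element of the finite set `P`.
-/

namespace SigGB

/-! ### Terms -/

section Terms

variable {n m : ℕ}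

theorem Term.shift_zero (u : Term n m) : u.shift 0 = u := by
  ext <;> simp [Term.shift]

theorem Term.shift_shift (s t : Fin n →₀ ℕ) (u : Term n m) :
    (u.shift t).shift s = u.shift (s + t) := by
  ext <;> simp [Term.shift, add_assoc]

theorem Term.shift_injective (t : Fin n →₀ ℕ) :
    Function.Injective (Term.shift t : Term n m → Term n m) := by
  rintro ⟨a, i⟩ ⟨b, j⟩ h
  simpa [Term.shift] using h

/-- Dickson's lemma for terms paired with power-products. -/
theorem wellQuasiOrdered_term_prod :
    WellQuasiOrdered fun a b : Term n m × (Fin n →₀ ℕ) =>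
      a.1.comp = b.1.comp ∧ a.1.pp ≤ b.1.pp ∧ a.2 ≤ b.2 := by
  intro g
  have h1 : WellQuasiOrdered ((· = ·) : Fin m → Fin m → Prop) := Finite.wellQuasiOrdered _
  have h2 : WellQuasiOrdered ((· ≤ ·) : (Fin n →₀ ℕ) → (Fin n →₀ ℕ) → Prop) :=
    wellQuasiOrdered_le
  obtain ⟨i, j, hij, h⟩ := (h1.prod (h2.prod h2)) fun k => ((g k).1.comp, (g k).1.pp, (g k).2)
  exact ⟨i, j, hij, h⟩

/-- In a well-quasi-order every set is dominated from below by a finite subset. -/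
theorem _root_.WellQuasiOrdered.exists_finite_subset {α β : Type*} {r : β → β → Prop}
    (hr : WellQuasiOrdered r) (φ : α → β) (A : Set α) :
    ∃ D : Set α, D.Finite ∧ D ⊆ A ∧ ∀ b ∈ A, ∃ d ∈ D, r (φ d) (φ b) := by
  by_contra hcon
  push Not at hcon
  obtain ⟨g, -, hg⟩ := exists_seq_of_forall_finset_exists (· ∈ A) (fun x y => ¬ r (φ x) (φ y))
    fun s hs => hcon s s.finite_toSet hs
  obtain ⟨i, j, hij, h⟩ := hr (φ ∘ g)
  exact hg i j hij h

theorem shiftBot_coe (t : Fin n →₀ ℕ) (u : Term n m) :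
    shiftBot t (u : WithBot (Term n m)) = (u.shift t : Term n m) := rfl

theorem shiftBot_bot (t : Fin n →₀ ℕ) : shiftBot t (⊥ : WithBot (Term n m)) = ⊥ := rfl

theorem shiftBot_zero (u : WithBot (Term n m)) : shiftBot 0 u = u := by
  induction u with
  | bot => rfl
  | coe u => rw [shiftBot_coe, Term.shift_zero]

theorem shiftBot_shiftBot (s t : Fin n →₀ ℕ) (u : WithBot (Term n m)) :
    shiftBot s (shiftBot t u) = shiftBot (s + t) u := by
  induction u with
  | bot => rfl
  | coe u => simp only [shiftBot_coe, Term.shift_shift]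

theorem TermDvd.refl (u : WithBot (Term n m)) : TermDvd u u := ⟨0, (shiftBot_zero u).symm⟩

theorem TermDvd.shiftBot (t : Fin n →₀ ℕ) (u : WithBot (Term n m)) :
    TermDvd u (SigGB.shiftBot t u) := ⟨t, rfl⟩

theorem TermDvd.trans {u v w : WithBot (Term n m)} (h₁ : TermDvd u v) (h₂ : TermDvd v w) :
    TermDvd u w := by
  obtain ⟨s, rfl⟩ := h₁
  obtain ⟨t, rfl⟩ := h₂
  exact ⟨t + s, shiftBot_shiftBot _ _ _⟩

end Terms

section TermOrder

variable {n m : ℕ} [LinearOrder (Term n m)] {ord : MonomialOrder (Fin n)}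

namespace IsCompatibleTermOrder

theorem wellFoundedLT (hord : IsCompatibleTermOrder (m := m) ord) :
    WellFoundedLT (Term n m) := by
  refine ⟨RelEmbedding.wellFounded_iff_isEmpty.mpr ⟨fun g => ?_⟩⟩
  obtain ⟨i, j, hij, hc, hp, -⟩ :=
    wellQuasiOrdered_term_prod (n := n) (m := m) fun k => (g k, 0)
  refine absurd (g.map_rel_iff.mpr hij) (not_lt.mpr ?_)
  have h := hord.compatible _ _ (g i).comp (ord.toSyn_monotone hp)
  have hj : g j = ⟨(g j).pp, (g i).comp⟩ := by
    dsimp only at hc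
    rw [hc]
  rwa [hj]

theorem shiftBot_le_shiftBot_iff (hord : IsCompatibleTermOrder (m := m) ord)
    {t : Fin n →₀ ℕ} {u v : WithBot (Term n m)} : shiftBot t u ≤ shiftBot t v ↔ u ≤ v := by
  have hmono : StrictMono (Term.shift t : Term n m → Term n m) :=
    Monotone.strictMono_of_injective (fun u v => hord.shift_le_shift t u v)
      (Term.shift_injective t)
  exact hmono.withBot_map.le_iff_le

theorem shiftBot_lt_shiftBot_iff (hord : IsCompatibleTermOrder (m := m) ord)
    {t : Fin n →₀ ℕ} {u v : WithBot (Term n m)} : shiftBot t u < shiftBot t v ↔ u < v := by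
  rw [← not_le, hord.shiftBot_le_shiftBot_iff, not_le]

theorem shiftBot_mono_left (hord : IsCompatibleTermOrder (m := m) ord)
    {s t : Fin n →₀ ℕ} (h : s ≼[ord] t) (u : WithBot (Term n m)) :
    shiftBot s u ≤ shiftBot t u := by
  induction u with
  | bot => exact le_rfl
  | coe u =>
    refine WithBot.coe_le_coe.mpr (hord.compatible _ _ _ ?_)
    simpa using h

theorem shiftBot_strictMono_left (hord : IsCompatibleTermOrder (m := m) ord)
    {s t : Fin n →₀ ℕ} (h : s ≺[ord] t) {u : WithBot (Term n m)} (hu : u ≠ ⊥) :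
    shiftBot s u < shiftBot t u := by
  lift u to Term n m using hu
  refine lt_of_le_of_ne (hord.shiftBot_mono_left h.le _) fun h' => ?_
  simp only [shiftBot_coe, WithBot.coe_inj, Term.shift, Term.mk.injEq, add_left_inj,
    and_true] at h'
  exact h.ne (by rw [h'])

theorem le_shiftBot (hord : IsCompatibleTermOrder (m := m) ord)
    (t : Fin n →₀ ℕ) (u : WithBot (Term n m)) : u ≤ shiftBot t u := by
  have h := hord.shiftBot_mono_left (s := 0) (t := t)
    (ord.toSyn_monotone (zero_le : 0 ≤ t)) u
  rwa [shiftBot_zero] at h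

theorem le_of_termDvd (hord : IsCompatibleTermOrder (m := m) ord)
    {u v : WithBot (Term n m)} (h : TermDvd u v) : u ≤ v := by
  obtain ⟨t, rfl⟩ := h
  exact hord.le_shiftBot t u

end IsCompatibleTermOrder

end TermOrder

/-! ### Signatures -/

section Sig

variable {K : Type*} [Field K] {n m : ℕ}

/-- The coefficient of a term in a module element. -/
noncomputable def coeffAt (u : Term n m) (a : FreeMod K n m) : K := (a u.comp).coeff u.pp

theorem coeffAt_sub (u : Term n m) (a b : FreeMod K n m) :
    coeffAt u (a - b) = coeffAt u a - coeffAt u b := by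
  simp [coeffAt]

theorem coeffAt_C_smul (u : Term n m) (c : K) (a : FreeMod K n m) :
    coeffAt u ((MvPolynomial.C c : MvPolynomial (Fin n) K) • a : FreeMod K n m) =
      c * coeffAt u a := by
  simp [coeffAt]

theorem coeffAt_monomial_smul (u : Term n m) (t : Fin n →₀ ℕ) (c : K) (a : FreeMod K n m) :
    coeffAt (u.shift t) (MvPolynomial.monomial t c • a : FreeMod K n m) = c * coeffAt u a := by
  simp [coeffAt, Term.shift, MvPolynomial.coeff_monomial_mul]

theorem exists_of_coeffAt_monomial_smul_ne_zero {u : Term n m} {t : Fin n →₀ ℕ} {c : K}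
    {a : FreeMod K n m} (h : coeffAt u (MvPolynomial.monomial t c • a : FreeMod K n m) ≠ 0) :
    ∃ v : Term n m, u = v.shift t ∧ coeffAt v a ≠ 0 := by
  classical
  simp only [coeffAt, Pi.smul_apply, smul_eq_mul, MvPolynomial.coeff_monomial_mul', ne_eq,
    ite_eq_right_iff, not_forall] at h
  obtain ⟨hle, h⟩ := h
  refine ⟨⟨u.pp - t, u.comp⟩, ?_, right_ne_zero_of_mul h⟩
  ext1
  · exact (add_tsub_cancel_of_le hle).symm
  · rfl

variable [LinearOrder (Term n m)]

theorem sig_le_iff {a : FreeMod K n m} {B : WithBot (Term n m)} :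
    sig a ≤ B ↔ ∀ u : Term n m, coeffAt u a ≠ 0 → (u : WithBot (Term n m)) ≤ B := by
  simp only [sig, Finset.max_le_iff, mem_supp, coeffAt]

theorem sig_lt_iff {a : FreeMod K n m} {u : Term n m} :
    sig a < u ↔ ∀ v : Term n m, coeffAt v a ≠ 0 → v < u := by
  rw [sig, Finset.max_eq_sup_withBot, Finset.sup_lt_iff (WithBot.bot_lt_coe u)]
  simp only [mem_supp, coeffAt, WithBot.coe_lt_coe]

theorem coe_le_sig {a : FreeMod K n m} {u : Term n m} (h : coeffAt u a ≠ 0) :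
    (u : WithBot (Term n m)) ≤ sig a := sig_le_iff.mp le_rfl u h

theorem coeffAt_ne_zero_of_sig_eq {a : FreeMod K n m} {u : Term n m} (h : sig a = u) :
    coeffAt u a ≠ 0 := (mem_supp a u).mp (Finset.mem_of_max h)

theorem sig_zero : sig (0 : FreeMod K n m) = ⊥ :=
  le_bot_iff.mp (sig_le_iff.mpr fun u hu => absurd (by simp [coeffAt]) hu)

theorem ne_zero_of_sig_eq {a : FreeMod K n m} {u : Term n m} (h : sig a = u) : a ≠ 0 := by
  rintro rfl
  simp [sig_zero] at h

theorem sig_eq_of {a : FreeMod K n m} {u : Term n m} (h0 : coeffAt u a ≠ 0)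
    (h : sig a ≤ u) : sig a = u := le_antisymm h (coe_le_sig h0)

theorem exists_sig_eq {a : FreeMod K n m} (ha : a ≠ 0) :
    ∃ u : Term n m, sig a = u := by
  obtain ⟨u, hu⟩ := WithBot.ne_bot_iff_exists.mp (sig_ne_bot ha)
  exact ⟨u, hu.symm⟩

theorem sig_basisVec (i : Fin m) :
    sig (basisVec K i : FreeMod K n m) = (⟨0, i⟩ : Term n m) := by
  have key : ∀ u : Term n m, coeffAt u (basisVec K i : FreeMod K n m) ≠ 0 ↔ u = ⟨0, i⟩ := by
    rintro ⟨t, j⟩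
    by_cases hj : j = i
    · subst hj
      simp [coeffAt, basisVec, MvPolynomial.coeff_one, eq_comm]
    · simp [coeffAt, basisVec, hj]
  refine sig_eq_of ((key _).mpr rfl) (sig_le_iff.mpr fun u hu => ?_)
  rw [(key u).mp hu]

theorem sig_sub_le {a b : FreeMod K n m} {B : WithBot (Term n m)} (ha : sig a ≤ B)
    (hb : sig b ≤ B) : sig (a - b) ≤ B := by
  rw [sig_le_iff] at *
  intro u hu
  rw [coeffAt_sub] at hu
  by_cases h : coeffAt u a = 0
  · exact hb u fun h' => hu (by simp [h, h'])
  · exact ha u h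

theorem sig_sub_eq_left {a b : FreeMod K n m} (h : sig b < sig a) : sig (a - b) = sig a := by
  obtain ⟨u, hu⟩ := WithBot.ne_bot_iff_exists.mp (bot_le.trans_lt h).ne'
  rw [← hu]
  refine sig_eq_of ?_ (sig_sub_le hu.ge (hu ▸ h.le))
  have hb : coeffAt u b = 0 := by
    by_contra hb
    exact (coe_le_sig hb).not_gt (hu ▸ h)
  rw [coeffAt_sub, hb, sub_zero]
  exact coeffAt_ne_zero_of_sig_eq hu.symm

theorem sig_sub_comm (a b : FreeMod K n m) : sig (a - b) = sig (b - a) := by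
  have : ∀ a b : FreeMod K n m, sig (a - b) ≤ sig (b - a) := fun a b =>
    sig_le_iff.mpr fun u hu => coe_le_sig (by
      rw [coeffAt_sub] at hu ⊢
      rwa [← neg_sub, neg_ne_zero])
  exact le_antisymm (this a b) (this b a)

theorem sig_sub_eq_max {a b : FreeMod K n m} (h : sig a ≠ sig b) :
    sig (a - b) = max (sig a) (sig b) := by
  rcases lt_or_gt_of_ne h with h | h
  · rw [sig_sub_comm, sig_sub_eq_left h, max_eq_right h.le]
  · rw [sig_sub_eq_left h, max_eq_left h.le]

/-- Two elements of equal signature can be scaled so that their leading terms cancel. -/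
theorem exists_sig_sub_C_smul_lt {a b : FreeMod K n m} {u : Term n m} (ha : sig a = u)
    (hb : sig b = u) : ∃ c : K,
      sig (a - (MvPolynomial.C c : MvPolynomial (Fin n) K) • b : FreeMod K n m) < u := by
  refine ⟨coeffAt u a / coeffAt u b, sig_lt_iff.mpr fun v hv => ?_⟩
  rw [coeffAt_sub, coeffAt_C_smul] at hv
  refine lt_of_le_of_ne ?_ ?_
  · by_cases h : coeffAt v a = 0
    · have hvb : coeffAt v b ≠ 0 := fun h' => hv (by simp [h, h'])
      exact WithBot.coe_le_coe.mp (hb ▸ coe_le_sig hvb)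
    · exact WithBot.coe_le_coe.mp (ha ▸ coe_le_sig h)
  · rintro rfl
    exact hv (by rw [div_mul_cancel₀ _ (coeffAt_ne_zero_of_sig_eq hb), sub_self])

variable {ord : MonomialOrder (Fin n)}

theorem sig_monomial_smul (hord : IsCompatibleTermOrder (m := m) ord) (t : Fin n →₀ ℕ) {c : K}
    (hc : c ≠ 0) (a : FreeMod K n m) :
    sig (MvPolynomial.monomial t c • a : FreeMod K n m) = shiftBot t (sig a) := by
  apply le_antisymm
  · refine sig_le_iff.mpr fun u hu => ?_
    obtain ⟨v, rfl, hv⟩ := exists_of_coeffAt_monomial_smul_ne_zero hu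
    rw [← shiftBot_coe, hord.shiftBot_le_shiftBot_iff]
    exact coe_le_sig hv
  · by_cases ha : a = 0
    · rw [ha, sig_zero, shiftBot_bot]
      exact bot_le
    · obtain ⟨u, hu⟩ := exists_sig_eq ha
      rw [hu, shiftBot_coe]
      apply coe_le_sig
      rw [coeffAt_monomial_smul]
      exact mul_ne_zero hc (coeffAt_ne_zero_of_sig_eq hu)

theorem sig_monomial_smul_le (hord : IsCompatibleTermOrder (m := m) ord) (t : Fin n →₀ ℕ) (c : K)
    (a : FreeMod K n m) :
    sig (MvPolynomial.monomial t c • a : FreeMod K n m) ≤ shiftBot t (sig a) := by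
  by_cases hc : c = 0
  · simp [hc, sig_zero]
  · exact (sig_monomial_smul hord t hc a).le

end Sig

/-! ### Signature reduction -/

section PolyCoeff

variable {K : Type*} [Field K] {n : ℕ} {ord : MonomialOrder (Fin n)}

theorem coeff_monomial_mul_eq_zero_of_lt {t x : Fin n →₀ ℕ} {p : MvPolynomial (Fin n) K} (c : K)
    (h : t + ord.degree p ≺[ord] x) : (MvPolynomial.monomial t c * p).coeff x = 0 := by
  classical
  rw [MvPolynomial.coeff_monomial_mul']
  split_ifs with hle
  · obtain ⟨y, rfl⟩ := exists_add_of_le hle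
    rw [map_add, map_add, add_lt_add_iff_left] at h
    rw [add_tsub_cancel_left, ord.coeff_eq_zero_of_lt h, mul_zero]
  · rfl

theorem degree_monomial_one_mul {p : MvPolynomial (Fin n) K} (hp : p ≠ 0) (t : Fin n →₀ ℕ) :
    ord.degree (MvPolynomial.monomial t (1 : K) * p) = t + ord.degree p := by
  classical
  rw [ord.degree_mul (by simp) hp, ord.degree_monomial, if_neg one_ne_zero]

theorem degree_eq_of_coeff {p : MvPolynomial (Fin n) K} {L : Fin n →₀ ℕ} (h : p.coeff L ≠ 0)
    (hL : ∀ x, L ≺[ord] x → p.coeff x = 0) : ord.degree p = L := by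
  have h1 := ord.le_degree (MvPolynomial.mem_support_iff.mpr h)
  rcases h1.lt_or_eq with h1 | h1
  · have hp : p ≠ 0 := by
      rintro rfl
      simp at h
    exact absurd (hL _ h1) (ord.coeff_degree_ne_zero_iff.mpr hp)
  · exact (ord.toSyn.injective h1).symm

end PolyCoeff

section Reduction

variable {K : Type*} [Field K] {n m : ℕ} {ord : MonomialOrder (Fin n)}
  {f : Fin m → MvPolynomial (Fin n) K}

theorem bar_basisVec (i : Fin m) : bar f (basisVec K i) = f i := by
  classical
  simp [bar, basisVec, Fintype.linearCombination_apply, Pi.single_apply]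

theorem bar_mem_span_range (a : FreeMod K n m) : bar f a ∈ Ideal.span (Set.range f) := by
  rw [bar, Fintype.linearCombination_apply]
  exact Ideal.sum_mem _ fun i _ => Ideal.mul_mem_left _ _ (Ideal.subset_span ⟨i, rfl⟩)

theorem bar_monomial_smul (t : Fin n →₀ ℕ) (c : K) (a : FreeMod K n m) :
    bar f (MvPolynomial.monomial t c • a) = MvPolynomial.monomial t c * bar f a := by
  rw [map_smul, smul_eq_mul]

variable [LinearOrder (Term n m)] {G : Set (FreeMod K n m)} {a b : FreeMod K n m}
  {r₁ : WithBot (Term n m) → WithBot (Term n m) → Prop}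
  {r₂ : (Fin n →₀ ℕ) → (Fin n →₀ ℕ) → Prop}

/-- The effect of a reduction step on the image polynomial: the coefficient of one power-product
is cancelled, and the coefficients of the larger ones stay the same. -/
theorem SigRed.exists_coeff (h : SigRed ord f r₁ r₂ G a b) :
    ∃ L, (bar f a).coeff L ≠ 0 ∧ (bar f b).coeff L = 0 ∧
      (∀ x, L ≺[ord] x → (bar f b).coeff x = (bar f a).coeff x) ∧
      ∃ g ∈ G, ∃ t, bar f g ≠ 0 ∧ t + ord.degree (bar f g) = L ∧
        r₁ (shiftBot t (sig g)) (sig a) := by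
  obtain ⟨g, hg, t, hg0, hL, rfl, h1, -⟩ := h
  refine ⟨t + ord.degree (bar f g), MvPolynomial.mem_support_iff.mp hL, ?_, fun x hx => ?_,
    g, hg, t, hg0, rfl, h1⟩
  · have hlc : ord.leadingCoeff (bar f g) ≠ 0 := ord.leadingCoeff_ne_zero_iff.mpr hg0
    rw [map_sub, bar_monomial_smul, MvPolynomial.coeff_sub, MvPolynomial.coeff_monomial_mul]
    exact sub_eq_zero.mpr (div_mul_cancel₀ _ hlc).symm
  · rw [map_sub, bar_monomial_smul, MvPolynomial.coeff_sub,
      coeff_monomial_mul_eq_zero_of_lt _ hx, sub_zero]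

theorem SigRed.sub_mem_span (h : SigRed ord f r₁ r₂ G a b) :
    bar f a - bar f b ∈ Ideal.span (bar f '' G) := by
  obtain ⟨g, hg, t, -, -, rfl, -⟩ := h
  rw [map_sub, sub_sub_cancel, bar_monomial_smul]
  exact Ideal.mul_mem_left _ _ (Ideal.subset_span ⟨g, hg, rfl⟩)

theorem SRed.sig_le (hord : IsCompatibleTermOrder (m := m) ord) (h : SRed ord f G a b) :
    sig b ≤ sig a := by
  obtain ⟨g, -, t, -, -, rfl, h1, -⟩ := h
  exact sig_sub_le le_rfl ((sig_monomial_smul_le hord _ _ _).trans h1)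

theorem RegSRed.sig_eq (hord : IsCompatibleTermOrder (m := m) ord) (h : RegSRed ord f G a b) :
    sig b = sig a := by
  obtain ⟨g, -, t, -, -, rfl, h1, -⟩ := h
  exact sig_sub_eq_left ((sig_monomial_smul_le hord _ _ _).trans_lt h1)

/-- Reduction terminates: the image polynomials descend in a lexicographic order in which a
coefficient counts only through whether it vanishes. -/
theorem wellFounded_sigRed : WellFounded fun b a => SigRed ord f r₁ r₂ G a b := by
  have hs : WellFounded fun x y : K => x = 0 ∧ y ≠ 0 :=
    ⟨fun y => ⟨y, fun x hx => ⟨x, fun z hz => absurd hx.1 hz.2⟩⟩⟩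
  let r : (Fin n →₀ ℕ) → (Fin n →₀ ℕ) → Prop := fun x y => y ≺[ord] x
  have : Std.Trichotomous r := ⟨fun x y hxy hyx =>
    ord.toSyn.injective (le_antisymm (not_lt.mp hxy) (not_lt.mp hyx))⟩
  have hr : WellFounded (Function.swap r) := InvImage.wf ord.toSyn wellFounded_lt
  have hlex : WellFounded (Finsupp.Lex r fun x y : K => x = 0 ∧ y ≠ 0) :=
    Finsupp.Lex.wellFounded' (fun _ h => h.2 rfl) hs hr
  refine Subrelation.wf (fun {b a} h => ?_)
    (InvImage.wf (fun a => AddMonoidAlgebra.coeff (bar f a)) hlex)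
  obtain ⟨L, h1, h2, h3, -⟩ := h.exists_coeff
  exact ⟨L, h3, h2, h1⟩

theorem exists_isRegNormalForm (a : FreeMod K n m) : ∃ b, IsRegNormalForm ord f G a b := by
  have hwf : WellFounded fun b a => RegSRed ord f G a b := wellFounded_sigRed
  induction a using hwf.induction with
  | _ a ih =>
    by_cases h : ∃ c, RegSRed ord f G a c
    · obtain ⟨c, hc⟩ := h
      obtain ⟨b, hb, hb'⟩ := ih c hc
      exact ⟨b, hb.head hc, hb'⟩
    · exact ⟨a, .refl, h⟩

theorem IsRegNormalForm.sig_eq (hord : IsCompatibleTermOrder (m := m) ord)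
    (h : IsRegNormalForm ord f G a b) : sig b = sig a := by
  obtain ⟨h, -⟩ := h
  induction h with
  | refl => rfl
  | tail _ h ih => exact (RegSRed.sig_eq hord h).trans ih

theorem IsRegNormalForm.coeff_eq_zero (h : IsRegNormalForm ord f G a b) {L : Fin n →₀ ℕ}
    (ha : ∀ x, L ≼[ord] x → (bar f a).coeff x = 0) :
    ∀ x, L ≼[ord] x → (bar f b).coeff x = 0 := by
  obtain ⟨h, -⟩ := h
  induction h with
  | refl => exact ha
  | tail _ h ih =>
    intro x hx
    obtain ⟨L', h1, -, h3, -⟩ := h.exists_coeff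
    rw [h3 x, ih x hx]
    refine lt_of_not_ge fun hlt => h1 (ih L' (hx.trans hlt))

theorem IsRegNormalForm.regTopIrred (h : IsRegNormalForm ord f G a b) :
    RegTopIrred ord f G b := by
  rintro ⟨c, g, hg, t, h1, h2, h3, h4, h5⟩
  exact h.2 ⟨c, g, hg, t, h1, h2, h3, h4, (congrArg ord.toSyn h5).le⟩

/-- `G` has a multiple `t g` with leading power-product `L` and signature below `u`. -/
def HasReducerLt (ord : MonomialOrder (Fin n)) (f : Fin m → MvPolynomial (Fin n) K)
    (G : Set (FreeMod K n m)) (L : Fin n →₀ ℕ) (u : WithBot (Term n m)) : Prop :=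
  ∃ g ∈ G, ∃ t : Fin n →₀ ℕ, bar f g ≠ 0 ∧ t + ord.degree (bar f g) = L ∧
    shiftBot t (sig g) < u

theorem regTopIrred_iff :
    RegTopIrred ord f G a ↔
      (bar f a ≠ 0 → ¬ HasReducerLt ord f G (ord.degree (bar f a)) (sig a)) := by
  constructor
  · rintro h h0 ⟨g, hg, t, hg0, ht, hs⟩
    exact h ⟨_, g, hg, t, hg0, ht ▸ ord.degree_mem_support h0, rfl, hs, ht⟩
  · rintro h ⟨b, g, hg, t, hg0, ht, -, hs, hd⟩
    refine h ?_ ⟨g, hg, t, hg0, hd, hs⟩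
    intro h0
    simp [h0] at ht

/-- If `d` s-reduces to zero, then the leading power-product of its image is cancelled at some
point of the reduction, by a multiple of an element of `G` of signature at most that of `d`. -/
theorem SRedZero.exists_reducer (hord : IsCompatibleTermOrder (m := m) ord)
    {d : FreeMod K n m} (h : SRedZero ord f G d) (hd : bar f d ≠ 0) :
    ∃ g ∈ G, ∃ t : Fin n →₀ ℕ, bar f g ≠ 0 ∧
      t + ord.degree (bar f g) = ord.degree (bar f d) ∧ shiftBot t (sig g) ≤ sig d := by
  obtain ⟨b, hred, hb⟩ := h
  suffices key : ∀ L, (bar f d).coeff L ≠ 0 → (∀ x, L ≺[ord] x → (bar f d).coeff x = 0) →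
      ∃ g ∈ G, ∃ t : Fin n →₀ ℕ, bar f g ≠ 0 ∧ t + ord.degree (bar f g) = L ∧
        shiftBot t (sig g) ≤ sig d from
    key _ (ord.coeff_degree_ne_zero_iff.mpr hd) fun x hx => ord.coeff_eq_zero_of_lt hx
  clear hd
  induction hred using Relation.ReflTransGen.head_induction_on with
  | refl =>
    intro L hL
    simp [hb] at hL
  | head hac _ ih =>
    intro L hL hgt
    obtain ⟨L', h1, -, h3, g, hg, t, hg0, ht, hs⟩ := hac.exists_coeff
    rcases lt_trichotomy (ord.toSyn L') (ord.toSyn L) with hlt | heq | hlt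
    · obtain ⟨g, hg, t, hg0, ht, hs⟩ := ih L (by rwa [h3 L hlt]) fun x hx => by
        rw [h3 x (hlt.trans hx), hgt x hx]
      exact ⟨g, hg, t, hg0, ht, hs.trans (SRed.sig_le hord hac)⟩
    · exact ⟨g, hg, t, hg0, ht.trans (ord.toSyn.injective heq), hs⟩
    · exact absurd (hgt L' hlt) h1

/-- Among the elements of a given signature, the regular top s-irreducible ones have the least
leading power-product, provided that `G` is a signature Gröbner basis up to this signature. -/
theorem RegTopIrred.degree_le (hord : IsCompatibleTermOrder (m := m) ord) {u : Term n m}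
    (hG : IsSigGBUpTo ord f G u) (ha : RegTopIrred ord f G a) (hau : sig a = u)
    (hbu : sig b = u) (ha0 : bar f a ≠ 0) :
    bar f b ≠ 0 ∧ ord.degree (bar f a) ≼[ord] ord.degree (bar f b) := by
  by_contra hcon
  obtain ⟨c, hc⟩ := exists_sig_sub_C_smul_lt hau hbu
  set d : FreeMod K n m := a - (MvPolynomial.C c : MvPolynomial (Fin n) K) • b with hd
  have hbx : ∀ x, ord.degree (bar f a) ≼[ord] x → (bar f b).coeff x = 0 := by
    intro x hx
    by_cases hb0 : bar f b = 0
    · simp [hb0]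
    · refine ord.coeff_eq_zero_of_lt (lt_of_lt_of_le ?_ hx)
      exact lt_of_not_ge fun h => hcon ⟨hb0, h⟩
  have hdx : ∀ x, ord.degree (bar f a) ≼[ord] x →
      (bar f d).coeff x = (bar f a).coeff x := by
    intro x hx
    rw [hd, map_sub, map_smul, smul_eq_mul, MvPolynomial.coeff_sub, MvPolynomial.coeff_C_mul,
      hbx x hx, mul_zero, sub_zero]
  have hdeg : (bar f d).coeff (ord.degree (bar f a)) ≠ 0 := by
    rw [hdx _ le_rfl]
    exact ord.coeff_degree_ne_zero_iff.mpr ha0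
  have hd0 : bar f d ≠ 0 := by
    intro h
    simp [h] at hdeg
  have hdd : ord.degree (bar f d) = ord.degree (bar f a) :=
    degree_eq_of_coeff hdeg fun x hx => by rw [hdx x hx.le, ord.coeff_eq_zero_of_lt hx]
  have hdne : d ≠ 0 := by
    intro h
    simp [h] at hd0
  obtain ⟨v, hv⟩ := exists_sig_eq hdne
  obtain ⟨g, hg, t, hg0, ht, hs⟩ := (hG v (hv ▸ hc) d hv).exists_reducer hord hd0
  exact regTopIrred_iff.mp ha ha0 ⟨g, hg, t, hg0, ht.trans hdd, hs.trans_lt (hau ▸ hc)⟩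

theorem RegTopIrred.bar_eq_zero_of_isSyzSig (hord : IsCompatibleTermOrder (m := m) ord)
    {u : Term n m} (hG : IsSigGBUpTo ord f G u) (ha : RegTopIrred ord f G a) (hau : sig a = u)
    (hu : IsSyzSig f u) : bar f a = 0 := by
  by_contra ha0
  obtain ⟨z, -, hz, hz0⟩ := hu
  exact (ha.degree_le hord hG hau hz ha0).1 hz0

theorem IsSyzSig.of_dvd (hord : IsCompatibleTermOrder (m := m) ord) {u v : Term n m}
    (hu : IsSyzSig f u) (h : TermDvd (u : WithBot (Term n m)) v) : IsSyzSig f v := by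
  obtain ⟨z, hz, hzu, hz0⟩ := hu
  obtain ⟨t, ht⟩ := h
  have hs : sig (MvPolynomial.monomial t (1 : K) • z : FreeMod K n m) = v := by
    rw [sig_monomial_smul hord t one_ne_zero, hzu, ht]
  exact ⟨_, ne_zero_of_sig_eq hs, hs, by rw [bar_monomial_smul, hz0, mul_zero]⟩

end Reduction

/-! ### Rewrite bases are signature Gröbner bases -/

section RewriteBasis

variable {K : Type*} [Field K] {n m : ℕ} {ord : MonomialOrder (Fin n)}
  {f : Fin m → MvPolynomial (Fin n) K} [LinearOrder (Term n m)] {G : Set (FreeMod K n m)}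
  {rw : SigPolyPair f → SigPolyPair f → Prop}

/-- Let `a` have signature `u` and be s-irreducible. If `ā ≠ 0`, then `u` is no syzygy signature, and
by minimality the irreducible multiple `t g` of signature `u` supplied by the rewrite basis has the
same leading power-product as `a`, so that it s-reduces `a` after all. -/
theorem IsRewriteBasisIn.isSigGBIn (hord : IsCompatibleTermOrder (m := m) ord) {u : Term n m}
    (hu : IsRewriteBasisIn ord f rw G u) (hG : IsSigGBUpTo ord f G u) :
    IsSigGBIn ord f G u := by
  intro a
  have hwf : WellFounded fun b a => SRed ord f G a b := wellFounded_sigRed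
  induction a using hwf.induction with
  | _ a ih =>
    intro hau
    by_cases ha0 : bar f a = 0
    · exact ⟨a, .refl, ha0⟩
    obtain ⟨b, hb⟩ : ∃ b, SRed ord f G a b := by
      by_contra hirr
      have hred : ∀ g ∈ G, ∀ t : Fin n →₀ ℕ, bar f g ≠ 0 →
          t + ord.degree (bar f g) = ord.degree (bar f a) → ¬ shiftBot t (sig g) ≤ sig a :=
        fun g hg t hg0 ht hs => hirr ⟨_, g, hg, t, hg0, ht ▸ ord.degree_mem_support ha0, rfl, hs,
          (congrArg ord.toSyn ht).le⟩
      have hair : RegTopIrred ord f G a := regTopIrred_iff.mpr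
        fun _ ⟨g, hg, t, hg0, ht, hs⟩ => hred g hg t hg0 ht hs.le
      rcases hu with hu | ⟨g, ⟨-, hg, -⟩, t, ht, hgir⟩
      · exact ha0 (hair.bar_eq_zero_of_isSyzSig hord hG hau hu)
      · have hsig : sig (MvPolynomial.monomial t (1 : K) • g : FreeMod K n m) = u := by
          rw [sig_monomial_smul hord t one_ne_zero, ht]
        obtain ⟨h0, hle⟩ := hair.degree_le hord hG hau hsig ha0
        have hle' := (hgir.degree_le hord hG hsig hau h0).2
        rw [bar_monomial_smul] at h0 hle hle'
        have hg0 : bar f g ≠ 0 := right_ne_zero_of_mul h0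
        rw [degree_monomial_one_mul hg0] at hle hle'
        exact hred g hg t hg0 (ord.toSyn.injective (le_antisymm hle' hle)) (hau ▸ ht ▸ le_rfl)
    have hzero : SRedZero ord f G b := by
      rcases (SRed.sig_le hord hb).lt_or_eq with hlt | heq
      · by_cases hb0 : b = 0
        · exact ⟨b, .refl, by rw [hb0, map_zero]⟩
        · obtain ⟨v, hv⟩ := exists_sig_eq hb0
          exact hG v (by rw [← hv, ← hau]; exact hlt) b hv
      · exact ih b hb (heq.trans hau)
    obtain ⟨c, hc, hc0⟩ := hzero
    exact ⟨c, hc.head hb, hc0⟩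

theorem isSigGBUpTo_of_isRewriteBasisIn (hord : IsCompatibleTermOrder (m := m) ord)
    {B : WithBot (Term n m)} (h : ∀ v : Term n m, v < B → IsRewriteBasisIn ord f rw G v) :
    IsSigGBUpTo ord f G B := by
  have := hord.wellFoundedLT
  intro v
  induction v using WellFoundedLT.induction with
  | _ v ih =>
    intro hv
    exact (h v hv).isSigGBIn hord fun w hw =>
      ih w (WithBot.coe_lt_coe.mp hw) (hw.trans hv)

end RewriteBasis

/-! ### S-pairs and canonical rewriters -/

section SPairs

variable {K : Type*} [Field K] {n m : ℕ} {ord : MonomialOrder (Fin n)}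
  {f : Fin m → MvPolynomial (Fin n) K}

theorem cofactor_add_degree (a b : FreeMod K n m) :
    cofactor ord f a b + ord.degree (bar f a) = ord.degree (bar f a) ⊔ ord.degree (bar f b) :=
  tsub_add_cancel_of_le le_sup_left

theorem cofactor_add_degree_right (a b : FreeMod K n m) :
    cofactor ord f b a + ord.degree (bar f b) = ord.degree (bar f a) ⊔ ord.degree (bar f b) := by
  rw [cofactor_add_degree, sup_comm]

theorem ne_zero_of_bar_ne_zero {a : FreeMod K n m} (h : bar f a ≠ 0) : a ≠ 0 := by
  rintro rfl
  exact h (map_zero _)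

theorem coeff_bar_spair {a b : FreeMod K n m} (ha : bar f a ≠ 0) (hb : bar f b ≠ 0)
    (x : Fin n →₀ ℕ) (hx : ord.degree (bar f a) ⊔ ord.degree (bar f b) ≼[ord] x) :
    (bar f (spair ord f a b)).coeff x = 0 := by
  have hla := ord.leadingCoeff_ne_zero_iff.mpr ha
  have hlb := ord.leadingCoeff_ne_zero_iff.mpr hb
  rw [spair, map_sub, bar_monomial_smul, bar_monomial_smul, MvPolynomial.coeff_sub]
  rcases hx.lt_or_eq with hx | hx
  · rw [coeff_monomial_mul_eq_zero_of_lt _ (by rwa [cofactor_add_degree]),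
      coeff_monomial_mul_eq_zero_of_lt _ (by rwa [cofactor_add_degree_right]), sub_zero]
  · obtain rfl := ord.toSyn.injective hx
    nth_rewrite 1 [← cofactor_add_degree a b]
    rw [← cofactor_add_degree_right a b, MvPolynomial.coeff_monomial_mul,
      MvPolynomial.coeff_monomial_mul]
    exact sub_eq_zero.mpr ((div_mul_cancel₀ _ hla).trans (div_mul_cancel₀ _ hlb).symm)

variable [LinearOrder (Term n m)]

theorem IsRegularSpair.symm {a b : FreeMod K n m} (h : IsRegularSpair ord f a b) :
    IsRegularSpair ord f b a := ⟨h.2.1, h.1, h.2.2.symm⟩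

theorem IsRegularSpair.sig_spair (hord : IsCompatibleTermOrder (m := m) ord)
    {a b : FreeMod K n m} (h : IsRegularSpair ord f a b) :
    sig (spair ord f a b) = max (pairSig ord f a b) (pairSig ord f b a) := by
  have ha := sig_monomial_smul hord (cofactor ord f a b)
    (one_div_ne_zero (ord.leadingCoeff_ne_zero_iff.mpr h.1)) a
  have hb := sig_monomial_smul hord (cofactor ord f b a)
    (one_div_ne_zero (ord.leadingCoeff_ne_zero_iff.mpr h.2.1)) b
  rw [spair, sig_sub_eq_max (by rw [ha, hb]; exact h.2.2), ha, hb]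
  rfl

/-- An element of a regular S-pair that carries the larger signature without a proper cofactor
is regular top s-reducible by the other one. -/
theorem not_regTopIrred_of_pairSig_lt (hord : IsCompatibleTermOrder (m := m) ord)
    {G : Set (FreeMod K n m)} {g h : FreeMod K n m} (hh : h ∈ G) (hg0 : bar f g ≠ 0)
    (hh0 : bar f h ≠ 0) (hlt : pairSig ord f h g < pairSig ord f g h)
    (hs : sig g = pairSig ord f g h) : ¬ RegTopIrred ord f G g := by
  rw [regTopIrred_iff]
  intro hirr
  refine hirr hg0 ⟨h, hh, cofactor ord f h g, hh0, ?_, hs ▸ hlt⟩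
  have hc : cofactor ord f g h = 0 := by
    by_contra hne
    have h0 : (0 : Fin n →₀ ℕ) ≺[ord] cofactor ord f g h := by
      rw [map_zero, ord.toSyn_lt_iff_ne_zero]
      simpa using hne
    have := hord.shiftBot_strictMono_left h0 (sig_ne_bot (ne_zero_of_bar_ne_zero hg0))
    rw [shiftBot_zero] at this
    exact this.ne hs
  rw [cofactor_add_degree_right, ← cofactor_add_degree, hc, zero_add]

variable {rw : SigPolyPair f → SigPolyPair f → Prop} {G : Set (FreeMod K n m)}

theorem IsCanonicalRewriter.of_dvd {u v : WithBot (Term n m)} {a : FreeMod K n m}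
    (h : IsCanonicalRewriter f rw G u a) (hv : TermDvd v u) (ha : TermDvd (sig a) v) :
    IsCanonicalRewriter f rw G v a := by
  obtain ⟨ha0, haG, -, hmax⟩ := h
  exact ⟨ha0, haG, ha, fun g hg hg0 hgv => hmax g hg hg0 (hgv.trans hv)⟩

theorem IsCanonicalRewriter.mono {G' : Set (FreeMod K n m)} (hG : G ⊆ G')
    {u : WithBot (Term n m)} {a : FreeMod K n m}
    (h : IsCanonicalRewriter f rw G' u a) (ha : a ∈ G) :
    IsCanonicalRewriter f rw G u a := by
  obtain ⟨ha0, -, hau, hmax⟩ := h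
  exact ⟨ha0, ha, hau, fun g hg => hmax g (hG hg)⟩

theorem _root_.Set.Finite.exists_forall_rel {α : Type*} {r : α → α → Prop}
    (htrans : ∀ x y z, r x y → r y z → r x z) (htotal : ∀ x y, r x y ∨ r y x) {A : Set α}
    (hA : A.Finite) (hne : A.Nonempty) : ∃ a ∈ A, ∀ x ∈ A, r x a := by
  induction A, hA using Set.Finite.induction_on with
  | empty => exact absurd hne Set.not_nonempty_empty
  | @insert x s _ _ ih =>
    rcases s.eq_empty_or_nonempty with rfl | hs
    · refine ⟨x, Set.mem_insert x _, ?_⟩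
      rintro y (rfl | hy)
      · exact (htotal y y).elim id id
      · exact absurd hy (Set.notMem_empty y)
    · obtain ⟨a, ha, hmax⟩ := ih hs
      rcases htotal x a with h | h
      · refine ⟨a, Set.mem_insert_of_mem _ ha, ?_⟩
        rintro y (rfl | hy)
        exacts [h, hmax y hy]
      · refine ⟨x, Set.mem_insert x _, ?_⟩
        rintro y (rfl | hy)
        exacts [(htotal y y).elim id id, htrans _ _ _ (hmax y hy) h]

theorem exists_isCanonicalRewriter (hrw : IsRewriteOrder ord f rw) (hG : G.Finite)
    {u : WithBot (Term n m)} {g : FreeMod K n m} (hg : g ∈ G) (hg0 : g ≠ 0)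
    (hgu : TermDvd (sig g) u) : ∃ a, IsCanonicalRewriter f rw G u a := by
  let A : Set {a : FreeMod K n m // a ≠ 0} := {a | a.1 ∈ G ∧ TermDvd (sig a.1) u}
  have hA : A.Finite :=
    (hG.preimage Subtype.val_injective.injOn).subset fun a ha => ha.1
  let r : {a : FreeMod K n m // a ≠ 0} → {a : FreeMod K n m // a ≠ 0} → Prop :=
    fun a b => rw (sppOf f a.1 a.2) (sppOf f b.1 b.2)
  have htrans : ∀ x y z, r x y → r y z → r x z := fun x y z hxy hyz =>
    hrw.trans _ (sppOf f y.1 y.2) _ hxy hyz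
  have htotal : ∀ x y, r x y ∨ r y x := fun x y => hrw.total _ _
  obtain ⟨⟨a, ha0⟩, ⟨ha, hau⟩, hmax⟩ :=
    Set.Finite.exists_forall_rel htrans htotal hA ⟨⟨g, hg0⟩, hg, hgu⟩
  exact ⟨a, ha0, ha, hau, fun b hb hb0 hbu => hmax ⟨b, hb0⟩ ⟨hb, hbu⟩⟩

/-- If `g` is a canonical rewriter in the larger signature `u` of a regular S-pair, then no element
`b` of signature `u` can have been found before: condition (ii) on rewrite orders puts `g` below
`b`, so that `g` has signature `u` itself and is regular top s-reducible. -/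
theorem IsCanonicalRewriter.sig_ne (hord : IsCompatibleTermOrder (m := m) ord)
    (hrw : IsRewriteOrder ord f rw) (hbar : ∀ g ∈ G, bar f g ≠ 0)
    (hirr : ∀ g ∈ G, RegTopIrred ord f G g) {g h : FreeMod K n m} (hh : h ∈ G)
    (hlt : pairSig ord f h g < pairSig ord f g h)
    (hGB : IsSigGBUpTo ord f G (pairSig ord f g h))
    (hcan : IsCanonicalRewriter f rw G (pairSig ord f g h) g) :
    ∀ b ∈ G, sig b ≠ pairSig ord f g h := by
  intro b hb hs
  obtain ⟨hg0, hg, hgu, hmax⟩ := hcan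
  have hb0 := ne_zero_of_bar_ne_zero (hbar b hb)
  have h1 := hrw.dvd G g b hg0 hb0 (hs ▸ hGB) hg hb (hs ▸ hgu) (hirr b hb)
  have h2 := hmax b hb hb0 (hs ▸ TermDvd.refl _)
  have h3 : sig g = sig b := by
    have := congrArg (WithBot.some) (hrw.sig_eq _ _ h1 h2)
    simpa [sppOf] using this
  exact not_regTopIrred_of_pairSig_lt hord hh (hbar g hg) (hbar h hh) hlt (h3.trans hs)
    (hirr g hg)

end SPairs

/-! ### The loop invariant -/

section Invariant

variable {K : Type*} [Field K] {n m : ℕ} [LinearOrder (Term n m)]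

/-- An entry of `P` that needs no further treatment: an element of its signature is in `G`, or
it is rejected by the criterion for the set of all syzygy signatures. -/
def Handled (ord : MonomialOrder (Fin n)) (f : Fin m → MvPolynomial (Fin n) K)
    (rw : SigPolyPair f → SigPolyPair f → Prop) (G : Set (FreeMod K n m))
    (p : CritElem K n m) : Prop :=
  (∃ g ∈ G, sig g = sig (p.toMod ord f)) ∨ SigCrit ord f rw G {u | IsSyzSig f u} p

/-- The loop invariant of the algorithm. The field `parents` traces every element of `G` back to a
basis vector or to an S-pair of elements of `G`; it serves the termination proof. -/
structure RBInvariant (ord : MonomialOrder (Fin n)) (f : Fin m → MvPolynomial (Fin n) K)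
    (rw : SigPolyPair f → SigPolyPair f → Prop) (s : RBState K n m) : Prop where
  finite_G : s.G.Finite
  finite_P : s.P.Finite
  bar_ne_zero : ∀ g ∈ s.G, bar f g ≠ 0
  irred : ∀ g ∈ s.G, RegTopIrred ord f s.G g
  isSyzSig : ∀ u ∈ s.S, IsSyzSig f u
  sig_inj : ∀ g ∈ s.G, ∀ h ∈ s.G, sig g = sig h → g = h
  sig_le : ∀ g ∈ s.G, ∀ p ∈ s.P, sig g ≤ sig (p.toMod ord f)
  mem_of_pair : ∀ a b, .pair a b ∈ s.P → a ∈ s.G ∧ b ∈ s.G ∧ IsRegularSpair ord f a b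
  sig_ne_basis : ∀ i, .basis i ∈ s.P → ∀ g ∈ s.G, sig g ≠ sig (basisVec K i : FreeMod K n m)
  basis_done : ∀ i, .basis i ∈ s.P ∨ Handled ord f rw s.G (.basis i)
  pair_done : ∀ a ∈ s.G, ∀ b ∈ s.G, IsRegularSpair ord f a b →
    (.pair a b ∈ s.P ∨ Handled ord f rw s.G (.pair a b)) ∨
      (.pair b a ∈ s.P ∨ Handled ord f rw s.G (.pair b a))
  parents : ∀ b ∈ s.G, (∃ i, sig b = sig (basisVec K i : FreeMod K n m)) ∨
    ∃ g ∈ s.G, ∃ h ∈ s.G, pairSig ord f h g < pairSig ord f g h ∧ sig b = pairSig ord f g h ∧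
      ord.degree (bar f b) ≺[ord] ord.degree (bar f g) ⊔ ord.degree (bar f h)

variable {ord : MonomialOrder (Fin n)} {f : Fin m → MvPolynomial (Fin n) K}
  {rw : SigPolyPair f → SigPolyPair f → Prop} {s : RBState K n m}

theorem SigCrit.mono {G G' : Set (FreeMod K n m)} {S S' : Set (Term n m)} (hG : G ⊆ G')
    (hS : S ⊆ S') {p : CritElem K n m} (hp : ∀ a b, p = .pair a b → a ∈ G ∧ b ∈ G)
    (h : SigCrit ord f rw G S p) : SigCrit ord f rw G' S' p := by
  cases p with
  | basis i =>
    obtain ⟨s, hs, hd⟩ := h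
    exact ⟨s, hS hs, hd⟩
  | pair a b =>
    obtain ⟨ha, hb⟩ := hp a b rfl
    rcases h with ⟨s, hs, hd⟩ | h | ⟨s, hs, hd⟩ | h
    · exact .inl ⟨s, hS hs, hd⟩
    · exact .inr (.inl fun h' => h (h'.mono hG ha))
    · exact .inr (.inr (.inl ⟨s, hS hs, hd⟩))
    · exact .inr (.inr (.inr fun h' => h (h'.mono hG hb)))

theorem Handled.mono {G G' : Set (FreeMod K n m)} (hG : G ⊆ G') {p : CritElem K n m}
    (hp : ∀ a b, p = .pair a b → a ∈ G ∧ b ∈ G)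
    (h : Handled ord f rw G p) : Handled ord f rw G' p := by
  rcases h with ⟨g, hg, hs⟩ | h
  · exact .inl ⟨g, hG hg, hs⟩
  · exact .inr (h.mono hG subset_rfl hp)

/-- A regular S-pair with the larger signature `u` on the side of `g`, where `g` is canonical in a
multiple of `u` that is not a syzygy signature, and `h` is canonical in such a multiple of its own
side, is not handled. -/
theorem not_handled_pair (hord : IsCompatibleTermOrder (m := m) ord)
    (hrw : IsRewriteOrder ord f rw) {G : Set (FreeMod K n m)} (hbar : ∀ g ∈ G, bar f g ≠ 0)
    (hirr : ∀ g ∈ G, RegTopIrred ord f G g) {g h : FreeMod K n m}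
    (hlt : pairSig ord f h g < pairSig ord f g h)
    (hGB : IsSigGBUpTo ord f G (pairSig ord f g h)) {u v : Term n m}
    (hg : IsCanonicalRewriter f rw G u g) (hh : IsCanonicalRewriter f rw G v h)
    (hu : ¬ IsSyzSig f u) (hv : ¬ IsSyzSig f v) (hgu : TermDvd (pairSig ord f g h) u)
    (hhv : TermDvd (pairSig ord f h g) v) :
    ¬ Handled ord f rw G (.pair g h) ∧ ¬ Handled ord f rw G (.pair h g) := by
  have hreg : IsRegularSpair ord f g h := ⟨hbar _ hg.2.1, hbar _ hh.2.1, hlt.ne'⟩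
  have hs1 : sig (spair ord f g h) = pairSig ord f g h := by
    rw [hreg.sig_spair hord, max_eq_left hlt.le]
  have hs2 : sig (spair ord f h g) = pairSig ord f g h := by
    rw [hreg.symm.sig_spair hord, max_eq_right hlt.le]
  have hcg : IsCanonicalRewriter f rw G (pairSig ord f g h) g :=
    hg.of_dvd hgu (TermDvd.shiftBot _ _)
  have hch : IsCanonicalRewriter f rw G (pairSig ord f h g) h :=
    hh.of_dvd hhv (TermDvd.shiftBot _ _)
  have hne := hcg.sig_ne hord hrw hbar hirr hh.2.1 hlt hGB
  constructor
  · rintro (⟨b, hb, hs⟩ | ⟨w, hw, hd⟩ | h' | ⟨w, hw, hd⟩ | h')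
    exacts [hne b hb (hs.trans hs1), hu (IsSyzSig.of_dvd hord hw (hd.trans hgu)), h' hcg,
      hv (IsSyzSig.of_dvd hord hw (hd.trans hhv)), h' hch]
  · rintro (⟨b, hb, hs⟩ | ⟨w, hw, hd⟩ | h' | ⟨w, hw, hd⟩ | h')
    exacts [hne b hb (hs.trans hs2), hv (IsSyzSig.of_dvd hord hw (hd.trans hhv)), h' hch,
      hu (IsSyzSig.of_dvd hord hw (hd.trans hgu)), h' hcg]

namespace RBInvariant

/-- Below the signatures of the remaining entries of `P`, the set `G` is a rewrite basis. -/
theorem isRewriteBasisIn (hord : IsCompatibleTermOrder (m := m) ord)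
    (hrw : IsRewriteOrder ord f rw) (inv : RBInvariant ord f rw s) (u : Term n m)
    (hu : ∀ p ∈ s.P, u < sig (p.toMod ord f)) : IsRewriteBasisIn ord f rw s.G u := by
  have := hord.wellFoundedLT
  induction u using WellFoundedLT.induction with
  | _ u ih =>
    have ih' : ∀ v : Term n m, v < u → IsRewriteBasisIn ord f rw s.G v := fun v hv =>
      ih v hv fun p hp => (WithBot.coe_lt_coe.mpr hv).trans (hu p hp)
    have hGB : ∀ B : WithBot (Term n m), B ≤ u → IsSigGBUpTo ord f s.G B := fun B hB =>
      isSigGBUpTo_of_isRewriteBasisIn (rw := rw) hord fun v hv =>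
        ih' v (WithBot.coe_lt_coe.mp (hv.trans_le hB))
    by_cases hsyz : IsSyzSig f u
    · exact .inl hsyz
    refine .inr ?_
    have hbu : TermDvd (sig (basisVec K u.comp : FreeMod K n m)) (u : WithBot (Term n m)) := by
      rw [sig_basisVec]
      refine ⟨u.pp, ?_⟩
      rw [shiftBot_coe]
      simp [Term.shift]
    obtain ⟨g, hcan⟩ : ∃ g, IsCanonicalRewriter f rw s.G u g := by
      rcases inv.basis_done u.comp with hP | ⟨g, hg, hs⟩ | ⟨w, hw, hd⟩
      · exact absurd (hu _ hP) (hord.le_of_termDvd hbu).not_gt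
      · exact exists_isCanonicalRewriter hrw inv.finite_G hg
          (ne_zero_of_bar_ne_zero (inv.bar_ne_zero g hg)) (hs ▸ hbu)
      · exact absurd (IsSyzSig.of_dvd hord hw (hd.trans hbu)) hsyz
    obtain ⟨t, ht⟩ := hcan.2.2.1
    have hg := hcan.2.1
    have hg0 := inv.bar_ne_zero g hg
    refine ⟨g, hcan, t, ht, regTopIrred_iff.mpr fun _ hred => ?_⟩
    rw [bar_monomial_smul, degree_monomial_one_mul hg0,
      sig_monomial_smul hord t one_ne_zero, ← ht] at hred
    set L := t + ord.degree (bar f g) with hL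
    -- Among the reducers of `t g`, one of minimal signature `v` is chosen.
    obtain ⟨v, ⟨hvu, h₁, hh₁, t₁, ht₁, hv₁⟩, hmin⟩ :
        ∃ v : Term n m, (v < u ∧ ∃ h ∈ s.G, ∃ t' : Fin n →₀ ℕ,
          t' + ord.degree (bar f h) = L ∧ shiftBot t' (sig h) = v) ∧
        ∀ w : Term n m, w < v → ¬ (w < u ∧ ∃ h ∈ s.G, ∃ t' : Fin n →₀ ℕ,
          t' + ord.degree (bar f h) = L ∧ shiftBot t' (sig h) = w) := by
      obtain ⟨h, hh, t', hh0, ht', hlt⟩ := hred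
      obtain ⟨w, hw⟩ := exists_sig_eq (ne_zero_of_bar_ne_zero hh0)
      rw [hw, shiftBot_coe, WithBot.coe_lt_coe] at hlt
      obtain ⟨v, hv, hmin⟩ := WellFounded.has_min (wellFounded_lt (α := Term n m))
        {v | v < u ∧ ∃ h ∈ s.G, ∃ t' : Fin n →₀ ℕ,
          t' + ord.degree (bar f h) = L ∧ shiftBot t' (sig h) = v}
        ⟨_, hlt, h, hh, t', ht', by rw [hw, shiftBot_coe]⟩
      exact ⟨v, hv, fun w hw hw' => hmin w hw' hw⟩
    have hvu' : (v : WithBot (Term n m)) < u := WithBot.coe_lt_coe.mpr hvu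
    have hh₁0 := inv.bar_ne_zero h₁ hh₁
    have hc0 : bar f (MvPolynomial.monomial t₁ (1 : K) • h₁ : FreeMod K n m) ≠ 0 := by
      rw [bar_monomial_smul]
      exact mul_ne_zero (by simp) hh₁0
    have hcsig : sig (MvPolynomial.monomial t₁ (1 : K) • h₁ : FreeMod K n m) = v := by
      rw [sig_monomial_smul hord t₁ one_ne_zero, hv₁]
    have hcdeg : ord.degree (bar f (MvPolynomial.monomial t₁ (1 : K) • h₁ : FreeMod K n m)) = L := by
      rw [bar_monomial_smul, degree_monomial_one_mul hh₁0, ht₁]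
    have hcirr : RegTopIrred ord f s.G (MvPolynomial.monomial t₁ (1 : K) • h₁) := by
      refine regTopIrred_iff.mpr fun _ ⟨h, hh, t', hh0, ht', hlt⟩ => ?_
      obtain ⟨w, hw⟩ := exists_sig_eq (ne_zero_of_bar_ne_zero hh0)
      rw [hcsig, hw, shiftBot_coe, WithBot.coe_lt_coe] at hlt
      exact hmin _ hlt ⟨hlt.trans hvu, h, hh, t', ht'.trans hcdeg, by rw [hw, shiftBot_coe]⟩
    have hvsyz : ¬ IsSyzSig f v := fun hv =>
      hc0 (hcirr.bar_eq_zero_of_isSyzSig hord (hGB v hvu'.le) hcsig hv)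
    -- The reducer may be replaced by the canonical rewriter `h` in `v`.
    obtain ⟨h, hhcan, t₂, ht₂, hhirr⟩ := (ih' v hvu).resolve_left hvsyz
    have hh0 := inv.bar_ne_zero h hhcan.2.1
    have hhsig : sig (MvPolynomial.monomial t₂ (1 : K) • h : FreeMod K n m) = v := by
      rw [sig_monomial_smul hord t₂ one_ne_zero, ht₂]
    have hhdeg : t₂ + ord.degree (bar f h) = L := by
      rw [← degree_monomial_one_mul hh0, ← bar_monomial_smul, ← hcdeg]
      obtain ⟨hd0, hle⟩ := hcirr.degree_le hord (hGB v hvu'.le) hcsig hhsig hc0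
      exact ord.toSyn.injective
        (le_antisymm (hhirr.degree_le hord (hGB v hvu'.le) hhsig hcsig hd0).2 hle)
    obtain ⟨w, hw⟩ : ∃ w, L = w + (ord.degree (bar f g) ⊔ ord.degree (bar f h)) := by
      obtain ⟨w, hw⟩ := exists_add_of_le
        (sup_le (hL ▸ le_add_self : ord.degree (bar f g) ≤ L) (hhdeg ▸ le_add_self))
      exact ⟨w, hw.trans (add_comm _ _)⟩
    have htg : t = w + cofactor ord f g h := by
      rw [hL, ← cofactor_add_degree, ← add_assoc] at hw
      exact add_right_cancel hw
    have hth : t₂ = w + cofactor ord f h g := by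
      rw [← hhdeg, ← cofactor_add_degree_right, ← add_assoc] at hw
      exact add_right_cancel hw
    have hgu : (u : WithBot (Term n m)) = shiftBot w (pairSig ord f g h) := by
      rw [ht, htg, ← shiftBot_shiftBot, pairSig]
    have hhv : (v : WithBot (Term n m)) = shiftBot w (pairSig ord f h g) := by
      rw [ht₂, hth, ← shiftBot_shiftBot, pairSig]
    have hlt : pairSig ord f h g < pairSig ord f g h := by
      rw [hgu, hhv, hord.shiftBot_lt_shiftBot_iff] at hvu'
      exact hvu'
    have hpu : pairSig ord f g h ≤ u := hord.le_of_termDvd ⟨w, hgu⟩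
    have hreg : IsRegularSpair ord f g h := ⟨hg0, hh0, hlt.ne'⟩
    obtain ⟨hn1, hn2⟩ := not_handled_pair hord hrw inv.bar_ne_zero inv.irred hlt (hGB _ hpu)
      hcan hhcan hsyz hvsyz ⟨w, hgu⟩ ⟨w, hhv⟩
    rcases inv.pair_done g hg h hhcan.2.1 hreg with (hP | hH) | hP | hH
    · refine absurd (hu _ hP) (not_lt.mpr ?_)
      rw [CritElem.toMod, hreg.sig_spair hord, max_eq_left hlt.le]
      exact hpu
    · exact hn1 hH
    · refine absurd (hu _ hP) (not_lt.mpr ?_)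
      rw [CritElem.toMod, hreg.symm.sig_spair hord, max_eq_right hlt.le]
      exact hpu
    · exact hn2 hH

theorem isSigGBUpTo (hord : IsCompatibleTermOrder (m := m) ord)
    (hrw : IsRewriteOrder ord f rw) (inv : RBInvariant ord f rw s) {B : WithBot (Term n m)}
    (hB : ∀ p ∈ s.P, B ≤ sig (p.toMod ord f)) : IsSigGBUpTo ord f s.G B :=
  isSigGBUpTo_of_isRewriteBasisIn (rw := rw) hord fun v hv =>
    inv.isRewriteBasisIn hord hrw v fun p hp => hv.trans_le (hB p hp)

end RBInvariant

end Invariant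

/-! ### Preservation of the loop invariant -/

section Preservation

variable {K : Type*} [Field K] {n m : ℕ} [LinearOrder (Term n m)] {ord : MonomialOrder (Fin n)}
  {f : Fin m → MvPolynomial (Fin n) K} {rw : SigPolyPair f → SigPolyPair f → Prop}
  {s : RBState K n m}

theorem isSyzSig_of_mem_newSyzSigs {G : Set (FreeMod K n m)} {p : CritElem K n m} {u : Term n m}
    (hu : u ∈ newSyzSigs f G p) : IsSyzSig f u := by
  cases p with
  | pair a b => exact absurd hu (Set.notMem_empty u)
  | basis i =>
    obtain ⟨g, -, hs⟩ := hu
    refine ⟨_, ne_zero_of_sig_eq hs, hs, ?_⟩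
    rw [map_sub, map_smul, map_smul, bar_basisVec, smul_eq_mul, smul_eq_mul, mul_comm, sub_self]

theorem rbInvariant_initState : RBInvariant ord f rw (initState f) where
  finite_G := Set.finite_empty
  finite_P := Set.finite_range _
  bar_ne_zero _ h := absurd h (Set.notMem_empty _)
  irred _ h := absurd h (Set.notMem_empty _)
  isSyzSig u := by
    rintro ⟨i, j, -, hs⟩
    refine ⟨_, ne_zero_of_sig_eq hs, hs, ?_⟩
    rw [map_sub, map_smul, map_smul, bar_basisVec, bar_basisVec, smul_eq_mul, smul_eq_mul,
      mul_comm, sub_self]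
  sig_inj _ h := absurd h (Set.notMem_empty _)
  sig_le _ h := absurd h (Set.notMem_empty _)
  mem_of_pair a b := by
    rintro ⟨i, hi⟩
    cases hi
  sig_ne_basis _ _ _ h := absurd h (Set.notMem_empty _)
  basis_done i := .inl ⟨i, rfl⟩
  pair_done _ h := absurd h (Set.notMem_empty _)
  parents _ h := absurd h (Set.notMem_empty _)

namespace RBInvariant

/-- Removing a handled entry from `P` preserves the invariant. -/
theorem erase (inv : RBInvariant ord f rw s) {p : CritElem K n m}
    (hp : Handled ord f rw s.G p) {S : Set (Term n m)} (hS : ∀ u ∈ S, IsSyzSig f u) :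
    RBInvariant ord f rw ⟨s.G, S, s.P \ {p}⟩ where
  finite_G := inv.finite_G
  finite_P := inv.finite_P.sdiff
  bar_ne_zero := inv.bar_ne_zero
  irred := inv.irred
  isSyzSig := hS
  sig_inj := inv.sig_inj
  sig_le g hg q hq := inv.sig_le g hg q hq.1
  mem_of_pair a b h := inv.mem_of_pair a b h.1
  sig_ne_basis i hi := inv.sig_ne_basis i hi.1
  basis_done i := by
    by_cases h : .basis i = p
    · exact .inr (h ▸ hp)
    · exact (inv.basis_done i).imp_left fun h' => ⟨h', h⟩
  pair_done a ha b hb hab := by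
    have key : ∀ q : CritElem K n m, (q ∈ s.P ∨ Handled ord f rw s.G q) →
        (q ∈ s.P \ {p} ∨ Handled ord f rw s.G q) := by
      intro q hq
      by_cases h : q = p
      · exact .inr (h ▸ hp)
      · exact hq.imp_left fun h' => ⟨h', h⟩
    exact (inv.pair_done a ha b hb hab).imp (key _) (key _)
  parents := inv.parents

/-- For an S-pair that passes the criterion, `g` denotes the element on the side of the larger
signature. -/
theorem exists_larger_side (hord : IsCompatibleTermOrder (m := m) ord)
    (inv : RBInvariant ord f rw s) {a b : FreeMod K n m} (hP : .pair a b ∈ s.P)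
    {S : Set (Term n m)} (hc : ¬ SigCrit ord f rw s.G S (.pair a b)) :
    ∃ g ∈ s.G, ∃ h ∈ s.G, pairSig ord f h g < pairSig ord f g h ∧
      sig (spair ord f a b) = pairSig ord f g h ∧
      IsCanonicalRewriter f rw s.G (pairSig ord f g h) g ∧
      ∀ x, ord.degree (bar f g) ⊔ ord.degree (bar f h) ≼[ord] x →
        (bar f (spair ord f a b)).coeff x = 0 := by
  obtain ⟨ha, hb, hreg⟩ := inv.mem_of_pair a b hP
  simp only [SigCrit, not_or, not_not] at hc
  have hcoeff := coeff_bar_spair (ord := ord) hreg.1 hreg.2.1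
  rcases lt_or_gt_of_ne hreg.2.2 with hlt | hlt
  · exact ⟨b, hb, a, ha, hlt, by rw [hreg.sig_spair hord, max_eq_right hlt.le], hc.2.2.2,
      by rwa [sup_comm]⟩
  · exact ⟨a, ha, b, hb, hlt, by rw [hreg.sig_spair hord, max_eq_left hlt.le], hc.2.1, hcoeff⟩

theorem exists_sig_toMod_eq (hord : IsCompatibleTermOrder (m := m) ord)
    (inv : RBInvariant ord f rw s) {p : CritElem K n m} (hp : p ∈ s.P) :
    ∃ u : Term n m, sig (p.toMod ord f) = u := by
  cases p with
  | basis i => exact ⟨_, sig_basisVec i⟩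
  | pair a b =>
    obtain ⟨ha, hb, hreg⟩ := inv.mem_of_pair a b hp
    refine exists_sig_eq fun h0 => ?_
    have hs := hreg.sig_spair hord
    rw [CritElem.toMod] at h0
    rw [h0, sig_zero, eq_comm, max_eq_bot] at hs
    exact hreg.2.2 (hs.1.trans hs.2.symm)

/-- An entry whose signature is a syzygy signature is handled. -/
theorem handled_of_isSyzSig (hord : IsCompatibleTermOrder (m := m) ord)
    (inv : RBInvariant ord f rw s) {p : CritElem K n m} (hp : p ∈ s.P) {u : Term n m}
    (hu : IsSyzSig f u) (hs : sig (p.toMod ord f) = u) : Handled ord f rw s.G p := by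
  refine .inr ?_
  cases p with
  | basis i => exact ⟨u, hu, hs ▸ TermDvd.refl _⟩
  | pair a b =>
    obtain ⟨ha, hb, hreg⟩ := inv.mem_of_pair a b hp
    rw [CritElem.toMod, hreg.sig_spair hord] at hs
    rcases max_choice (pairSig ord f a b) (pairSig ord f b a) with h | h
    · exact .inl ⟨u, hu, by rw [← hs, h]; exact TermDvd.refl _⟩
    · exact .inr (.inr (.inl ⟨u, hu, by rw [← hs, h]; exact TermDvd.refl _⟩))

/-- An entry that passes the criterion has a signature not yet present in `G`. -/
theorem sig_ne_toMod (hord : IsCompatibleTermOrder (m := m) ord)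
    (hrw : IsRewriteOrder ord f rw) (inv : RBInvariant ord f rw s) {p : CritElem K n m}
    (hp : IsMinSigIn ord f s.P p) {S : Set (Term n m)} (hc : ¬ SigCrit ord f rw s.G S p) :
    ∀ g ∈ s.G, sig g ≠ sig (p.toMod ord f) := by
  cases p with
  | basis i => exact inv.sig_ne_basis i hp.1
  | pair a b =>
    obtain ⟨g, hg, h, hh, hlt, hs, hcan, -⟩ := inv.exists_larger_side hord hp.1 hc
    intro c hcG
    rw [CritElem.toMod, hs]
    refine hcan.sig_ne hord hrw inv.bar_ne_zero inv.irred hh hlt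
      (inv.isSigGBUpTo hord hrw fun q hq => ?_) c hcG
    rw [← hs]
    exact hp.2 q hq

/-- Adding a regular s-normal form with nonzero image to `G` preserves the invariant. -/
theorem add (hord : IsCompatibleTermOrder (m := m) ord)
    (hrw : IsRewriteOrder ord f rw) (inv : RBInvariant ord f rw s) {p : CritElem K n m}
    {b : FreeMod K n m} (hp : IsMinSigIn ord f s.P p) {S : Set (Term n m)}
    (hS : ∀ u ∈ S, IsSyzSig f u) (hc : ¬ SigCrit ord f rw s.G S p)
    (hb : IsRegNormalForm ord f s.G (p.toMod ord f) b) (h0 : bar f b ≠ 0) :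
    RBInvariant ord f rw ⟨s.G ∪ {b}, S,
      s.P \ {p} ∪ {q | ∃ g ∈ s.G, IsRegularSpair ord f g b ∧ q = .pair g b}⟩ := by
  have hbs := hb.sig_eq hord
  have hne := inv.sig_ne_toMod hord hrw hp hc
  have hle : ∀ g ∈ s.G, sig g ≤ sig b := fun g hg => hbs ▸ inv.sig_le g hg p hp.1
  have hsub : s.G ⊆ s.G ∪ {b} := Set.subset_union_left
  have hbp : Handled ord f rw (s.G ∪ {b}) p := .inl ⟨b, .inr rfl, hbs⟩
  -- A reducer of signature below `sig b` is not a multiple of `b`.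
  have hirr : ∀ a : FreeMod K n m, RegTopIrred ord f s.G a → sig a ≤ sig b →
      RegTopIrred ord f (s.G ∪ {b}) a := by
    intro a ha hab
    refine regTopIrred_iff.mpr fun ha0 ⟨g, hg, t, hg0, ht, hs⟩ => ?_
    rcases hg with hg | rfl
    · exact regTopIrred_iff.mp ha ha0 ⟨g, hg, t, hg0, ht, hs⟩
    · exact ((hord.le_shiftBot t _).trans_lt hs).not_ge hab
  have hdone : ∀ q : CritElem K n m, (∀ x y, q = .pair x y → x ∈ s.G ∧ y ∈ s.G) →
      (q ∈ s.P ∨ Handled ord f rw s.G q) →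
      (q ∈ s.P \ {p} ∪ {q | ∃ g ∈ s.G, IsRegularSpair ord f g b ∧ q = .pair g b} ∨
        Handled ord f rw (s.G ∪ {b}) q) := by
    intro q hq h
    by_cases hqp : q = p
    · exact .inr (hqp ▸ hbp)
    · exact h.imp (fun h' => .inl ⟨h', hqp⟩) fun h' => h'.mono hsub hq
  have hpairs : ∀ g ∈ s.G, ∀ h ∈ s.G,
      ∀ x y, (.pair g h : CritElem K n m) = .pair x y → x ∈ s.G ∧ y ∈ s.G := by
    rintro g hg h hh x y hxy
    cases hxy
    exact ⟨hg, hh⟩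
  have hnew : ∀ q ∈ s.P \ {p} ∪ {q | ∃ g ∈ s.G, IsRegularSpair ord f g b ∧ q = .pair g b},
      sig b ≤ sig (q.toMod ord f) := by
    rintro q (hq | ⟨g, hg, hreg, rfl⟩)
    · exact hbs ▸ hp.2 q hq.1
    · rw [CritElem.toMod, hreg.sig_spair hord]
      exact (hord.le_shiftBot _ _).trans (le_max_right _ _)
  constructor
  · exact inv.finite_G.union (Set.finite_singleton b)
  · refine inv.finite_P.sdiff.union ((inv.finite_G.image fun g => .pair g b).subset ?_)
    rintro q ⟨g, hg, -, rfl⟩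
    exact ⟨g, hg, rfl⟩
  · rintro g (hg | rfl)
    exacts [inv.bar_ne_zero g hg, h0]
  · rintro g (hg | rfl)
    exacts [hirr g (inv.irred g hg) (hle g hg), hirr g hb.regTopIrred le_rfl]
  · exact hS
  · rintro g (hg | rfl) h (hh | rfl) hgh
    exacts [inv.sig_inj g hg h hh hgh, absurd (hgh.trans hbs) (hne g hg),
      absurd (hgh.symm.trans hbs) (hne h hh), rfl]
  · rintro g (hg | rfl) q hq
    exacts [(hle g hg).trans (hnew q hq), hnew q hq]
  · rintro x y (hxy | ⟨g, hg, hreg, hxy⟩)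
    · obtain ⟨hx, hy, hreg⟩ := inv.mem_of_pair x y hxy.1
      exact ⟨hsub hx, hsub hy, hreg⟩
    · cases hxy
      exact ⟨hsub hg, .inr rfl, hreg⟩
  · rintro i (hi | ⟨g, -, -, hig⟩) g' hg'
    · rcases hg' with hg' | rfl
      · exact inv.sig_ne_basis i hi.1 g' hg'
      · rw [hbs]
        cases p with
        | basis j =>
          intro h
          rw [CritElem.toMod, sig_basisVec, sig_basisVec, WithBot.coe_inj, Term.mk.injEq] at h
          exact hi.2 (by rw [h.2]; rfl)
        | pair x y =>
          -- A divisor of a basis vector is the basis vector itself.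
          obtain ⟨g, hg, h, -, -, hs, -⟩ := inv.exists_larger_side hord hp.1 hc
          intro heq
          rw [CritElem.toMod, hs, sig_basisVec] at heq
          obtain ⟨u, hu⟩ := exists_sig_eq (ne_zero_of_bar_ne_zero (inv.bar_ne_zero g hg))
          rw [pairSig, hu, shiftBot_coe, WithBot.coe_inj, Term.shift, Term.mk.injEq] at heq
          refine inv.sig_ne_basis i hi.1 g hg ?_
          rw [hu, sig_basisVec, WithBot.coe_inj]
          exact Term.ext (add_eq_zero.mp heq.1).2 heq.2
    · cases hig
  · exact fun i => hdone _ (fun x y h => by cases h) (inv.basis_done i)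
  · rintro g (hg | rfl) h (hh | rfl) hgh
    · exact (inv.pair_done g hg h hh hgh).imp (hdone _ (hpairs g hg h hh))
        (hdone _ (hpairs h hh g hg))
    · exact .inl (.inl (.inr ⟨g, hg, hgh, rfl⟩))
    · exact .inr (.inl (.inr ⟨h, hh, hgh.symm, rfl⟩))
    · exact absurd rfl hgh.2.2
  · rintro g (hg | rfl)
    · refine (inv.parents g hg).imp_right ?_
      rintro ⟨x, hx, y, hy, h⟩
      exact ⟨x, hsub hx, y, hsub hy, h⟩
    · cases p with
      | basis i => exact .inl ⟨i, hbs⟩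
      | pair x y =>
        obtain ⟨g', hg, h, hh, hlt, hs, -, hcoeff⟩ := inv.exists_larger_side hord hp.1 hc
        refine .inr ⟨g', hsub hg, h, hsub hh, hlt, hbs.trans hs, lt_of_not_ge fun hge => ?_⟩
        exact ord.coeff_degree_ne_zero_iff.mpr h0 (hb.coeff_eq_zero hcoeff _ hge)

theorem step (hord : IsCompatibleTermOrder (m := m) ord)
    (hrw : IsRewriteOrder ord f rw) (inv : RBInvariant ord f rw s) {s' : RBState K n m}
    (h : RBStep ord f rw s s') : RBInvariant ord f rw s' := by
  have hS : ∀ p, ∀ u ∈ s.S ∪ newSyzSigs f s.G p, IsSyzSig f u := by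
    rintro p u (hu | hu)
    exacts [inv.isSyzSig u hu, isSyzSig_of_mem_newSyzSigs hu]
  cases h with
  | skip p hp hc =>
    refine inv.erase (.inr (hc.mono subset_rfl (hS p) ?_)) (hS p)
    rintro a b rfl
    obtain ⟨ha, hb, -⟩ := inv.mem_of_pair a b hp.1
    exact ⟨ha, hb⟩
  | zero p b hp hc hb h0 =>
    have hbS : ∀ u : Term n m, sig b = u → IsSyzSig f u :=
      fun u hu => ⟨b, ne_zero_of_sig_eq hu, hu, h0⟩
    obtain ⟨u, hu⟩ := inv.exists_sig_toMod_eq hord hp.1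
    refine inv.erase
      (inv.handled_of_isSyzSig hord hp.1 (hbS u ((hb.sig_eq hord).trans hu)) hu) ?_
    rintro v (hv | hv)
    exacts [hS p v hv, hbS v hv]
  | add p b hp hc hb h0 => exact inv.add hord hrw hp (hS p) hc hb h0

theorem of_reachable (hord : IsCompatibleTermOrder (m := m) ord)
    (hrw : IsRewriteOrder ord f rw) (h : Reachable ord f rw s) : RBInvariant ord f rw s := by
  induction h with
  | refl => exact rbInvariant_initState
  | tail _ h ih => exact ih.step hord hrw h

/-- Every pass shrinks `P` or enlarges `G`. -/
theorem step_progress (hord : IsCompatibleTermOrder (m := m) ord)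
    (hrw : IsRewriteOrder ord f rw) (inv : RBInvariant ord f rw s) {s' : RBState K n m}
    (h : RBStep ord f rw s s') : (s'.G = s.G ∧ s'.P ⊂ s.P) ∨ s.G ⊂ s'.G := by
  cases h with
  | skip p hp hc => exact .inl ⟨rfl, Set.sdiff_singleton_ssubset.mpr hp.1⟩
  | zero p b hp hc hb h0 => exact .inl ⟨rfl, Set.sdiff_singleton_ssubset.mpr hp.1⟩
  | add p b hp hc hb h0 =>
    refine .inr ⟨Set.subset_union_left, fun hsub => ?_⟩
    exact inv.sig_ne_toMod hord hrw hp hc b (hsub (.inr rfl)) (hb.sig_eq hord)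

theorem exists_step (inv : RBInvariant ord f rw s) (hP : s.P.Nonempty) :
    ∃ s', RBStep ord f rw s s' := by
  obtain ⟨p, hp, hmin⟩ := Set.exists_min_image s.P (fun p => sig (p.toMod ord f)) inv.finite_P hP
  by_cases hc : SigCrit ord f rw s.G (s.S ∪ newSyzSigs f s.G p) p
  · exact ⟨_, .skip s p ⟨hp, hmin⟩ hc⟩
  obtain ⟨b, hb⟩ := exists_isRegNormalForm (ord := ord) (f := f) (G := s.G) (p.toMod ord f)
  by_cases h0 : bar f b = 0
  · exact ⟨_, .zero s p b ⟨hp, hmin⟩ hc hb h0⟩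
  · exact ⟨_, .add s p b ⟨hp, hmin⟩ hc hb h0⟩

/-- An element of `G` whose signature and leading power-product are both divisible by those of
another element has the same cofactor for both. -/
theorem shift_eq (hord : IsCompatibleTermOrder (m := m) ord)
    (hrw : IsRewriteOrder ord f rw) (inv : RBInvariant ord f rw s) {b g : FreeMod K n m}
    (hb : b ∈ s.G) (hg : g ∈ s.G) {t t' : Fin n →₀ ℕ} (hs : sig b = shiftBot t (sig g))
    (hd : ord.degree (bar f b) = t' + ord.degree (bar f g)) : t = t' := by
  have hb0 := inv.bar_ne_zero b hb
  have hg0 := inv.bar_ne_zero g hg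
  obtain ⟨u, hu⟩ := exists_sig_eq (ne_zero_of_bar_ne_zero hb0)
  have hGB : IsSigGBUpTo ord f s.G u := hu ▸ inv.isSigGBUpTo hord hrw fun p hp =>
    inv.sig_le b hb p hp
  have hsig : sig (MvPolynomial.monomial t (1 : K) • g : FreeMod K n m) = u := by
    rw [sig_monomial_smul hord t one_ne_zero, ← hs, hu]
  have hle := ((inv.irred b hb).degree_le hord hGB hu hsig hb0).2
  rw [bar_monomial_smul, degree_monomial_one_mul hg0, hd, map_add, map_add,
    add_le_add_iff_right] at hle
  rcases hle.lt_or_eq with hlt | heq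
  · refine absurd ⟨g, hg, t', hg0, hd.symm, ?_⟩ (regTopIrred_iff.mp (inv.irred b hb) hb0)
    rw [hs]
    exact hord.shiftBot_strictMono_left hlt (sig_ne_bot (ne_zero_of_bar_ne_zero hg0))
  · exact (ord.toSyn.injective heq).symm

end RBInvariant

end Preservation

/-! ### Termination -/

section Termination

variable {n m : ℕ} [LinearOrder (Term n m)] {ord : MonomialOrder (Fin n)}

/-- The comparison `u / p < v / q` of the ratios of a term and a power-product, with denominators
cleared. -/
def RatioLt (x y : Term n m × (Fin n →₀ ℕ)) : Prop := x.1.shift y.2 < y.1.shift x.2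

theorem IsCompatibleTermOrder.shift_lt_shift_iff (hord : IsCompatibleTermOrder (m := m) ord)
    {t : Fin n →₀ ℕ} {u v : Term n m} : u.shift t < v.shift t ↔ u < v := by
  have := hord.shiftBot_lt_shiftBot_iff (t := t) (u := (u : WithBot (Term n m))) (v := v)
  simpa only [shiftBot_coe, WithBot.coe_lt_coe] using this

theorem RatioLt.trans (hord : IsCompatibleTermOrder (m := m) ord)
    {x y z : Term n m × (Fin n →₀ ℕ)} (h₁ : RatioLt x y) (h₂ : RatioLt y z) : RatioLt x z := by
  have h₁' := (hord.shift_lt_shift_iff (t := z.2)).mpr h₁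
  have h₂' := (hord.shift_lt_shift_iff (t := x.2)).mpr h₂
  rw [Term.shift_shift, Term.shift_shift] at h₁' h₂'
  rw [RatioLt, ← hord.shift_lt_shift_iff (t := y.2), Term.shift_shift, Term.shift_shift]
  rw [add_comm z.2 x.2] at h₁'
  rw [add_comm y.2 z.2, add_comm y.2 x.2]
  exact h₁'.trans h₂'

/-- A set of pairs (signature, leading power-product) is finite if the two components determine the
same cofactor in every divisibility relation, and every pair arises from a basis vector or from an
S-pair of two members. By Dickson's lemma and the first condition only finitely many ratios occur;
by the second the parents of a member have smaller ratios than the member itself. -/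
theorem finite_of_parents (hord : IsCompatibleTermOrder (m := m) ord)
    {B : Set (Term n m × (Fin n →₀ ℕ))}
    (hinj : Set.InjOn Prod.fst B)
    (hshift : ∀ x ∈ B, ∀ y ∈ B, ∀ t t', x.1 = y.1.shift t → x.2 = t' + y.2 → t = t')
    (hpar : ∀ x ∈ B, (∃ i, x.1 = ⟨0, i⟩) ∨ ∃ y ∈ B, ∃ z ∈ B,
      z.1.shift ((z.2 ⊔ y.2) - z.2) < y.1.shift ((y.2 ⊔ z.2) - y.2) ∧
      x.1 = y.1.shift ((y.2 ⊔ z.2) - y.2) ∧ x.2 ≺[ord] y.2 ⊔ z.2) :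
    B.Finite := by
  obtain ⟨D, hDfin, hDB, hD⟩ := wellQuasiOrdered_term_prod.exists_finite_subset id B
  have hD' : ∀ x ∈ B, ∃ d ∈ D, ∃ t, x = (d.1.shift t, t + d.2) := by
    intro x hx
    obtain ⟨d, hd, hc, hp, hq⟩ := hD x hx
    obtain ⟨t, ht⟩ := exists_add_of_le hp
    obtain ⟨t', ht'⟩ := exists_add_of_le hq
    have h1 : x.1 = d.1.shift t := Term.ext (ht.trans (add_comm _ _)) hc.symm
    have h2 : x.2 = t' + d.2 := ht'.trans (add_comm _ _)
    obtain rfl := hshift x hx d (hDB hd) t t' h1 h2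
    exact ⟨d, hd, t, Prod.ext h1 h2⟩
  -- The rank of `x` is the number of representatives of smaller ratio.
  let ρ : Term n m × (Fin n →₀ ℕ) → ℕ := fun x => {d ∈ D | RatioLt d x}.ncard
  have hρ : ∀ x ∈ B, ∀ y, RatioLt x y → ρ x < ρ y := by
    intro x hx y hxy
    obtain ⟨d, hd, t, rfl⟩ := hD' x hx
    have hcomm : ((d.1.shift t).shift d.2 : Term n m) = d.1.shift (t + d.2) := by
      rw [Term.shift_shift, add_comm]
    have hdy : RatioLt d y := by
      rw [RatioLt, Term.shift_shift, add_comm, ← Term.shift_shift, ← Term.shift_shift,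
        hord.shift_lt_shift_iff] at hxy
      exact hxy
    refine Set.ncard_lt_ncard ⟨fun e he => ⟨he.1, RatioLt.trans hord he.2 hxy⟩, fun hsub => ?_⟩
      (hDfin.subset (Set.sep_subset _ _))
    have hlt : RatioLt d (d.1.shift t, t + d.2) := (hsub ⟨hd, hdy⟩).2
    exact hlt.ne hcomm.symm
  have hpar' : ∀ x ∈ B, (∃ i, x.1 = ⟨0, i⟩) ∨ ∃ y ∈ B, ∃ z ∈ B, ρ y < ρ x ∧ ρ z < ρ x ∧
      x.1 = y.1.shift ((y.2 ⊔ z.2) - y.2) := by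
    intro x hx
    refine (hpar x hx).imp_right ?_
    rintro ⟨y, hy, z, hz, hlt, hxy, hdeg⟩
    have hly : (y.2 ⊔ z.2) - y.2 + y.2 = y.2 ⊔ z.2 := tsub_add_cancel_of_le le_sup_left
    have hlz : (z.2 ⊔ y.2) - z.2 + z.2 = y.2 ⊔ z.2 := by
      rw [tsub_add_cancel_of_le le_sup_left, sup_comm]
    have hyx : RatioLt y x := by
      rw [RatioLt, hxy, Term.shift_shift, add_comm, hly]
      have := hord.shiftBot_strictMono_left hdeg (u := (y.1 : WithBot (Term n m)))
        WithBot.coe_ne_bot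
      exact WithBot.coe_lt_coe.mp this
    have hzy : RatioLt z y := by
      have h := (hord.shift_lt_shift_iff (t := y.2 + z.2)).mpr hlt
      have h1 : y.2 + z.2 + ((z.2 ⊔ y.2) - z.2) = (y.2 ⊔ z.2) + y.2 := by
        rw [add_assoc, add_comm z.2 ((z.2 ⊔ y.2) - z.2), hlz, add_comm]
      have h2 : y.2 + z.2 + ((y.2 ⊔ z.2) - y.2) = (y.2 ⊔ z.2) + z.2 := by
        rw [add_comm y.2 z.2, add_assoc, add_comm y.2 ((y.2 ⊔ z.2) - y.2), hly, add_comm]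
      rw [Term.shift_shift, Term.shift_shift, h1, h2, ← Term.shift_shift, ← Term.shift_shift,
        hord.shift_lt_shift_iff] at h
      exact h
    exact ⟨y, hy, z, hz, hρ y hy x hyx, hρ z hz x (hzy.trans hord hyx), hxy⟩
  have hfin : ∀ k, {x ∈ B | ρ x < k}.Finite := by
    intro k
    induction k with
    | zero => simp
    | succ k ih =>
      refine Set.Finite.of_finite_image (f := Prod.fst) ?_ (hinj.mono (Set.sep_subset _ _))
      refine ((Set.finite_range fun i : Fin m => (⟨0, i⟩ : Term n m)).union
        (ih.image2 (fun y z => y.1.shift ((y.2 ⊔ z.2) - y.2)) ih)).subset ?_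
      rintro _ ⟨x, ⟨hx, hxk⟩, rfl⟩
      rcases hpar' x hx with ⟨i, hi⟩ | ⟨y, hy, z, hz, hyx, hzx, hxy⟩
      · exact .inl ⟨i, hi.symm⟩
      · exact .inr ⟨y, ⟨hy, by omega⟩, z, ⟨hz, by omega⟩, hxy.symm⟩
  refine (hfin (D.ncard + 1)).subset fun x hx => ⟨hx, Nat.lt_succ_of_le ?_⟩
  exact Set.ncard_le_ncard (Set.sep_subset _ _) hDfin

variable {K : Type*} [Field K] {f : Fin m → MvPolynomial (Fin n) K}
  {rw : SigPolyPair f → SigPolyPair f → Prop}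

/-- Along any execution, only finitely many elements are ever added to `G`. -/
theorem finite_iUnion_G (hord : IsCompatibleTermOrder (m := m) ord)
    (hrw : IsRewriteOrder ord f rw) {run : ℕ → RBState K n m}
    (inv : ∀ k, RBInvariant ord f rw (run k)) (hmono : Monotone fun k => (run k).G) :
    (⋃ k, (run k).G).Finite := by
  set A := ⋃ k, (run k).G with hA
  have hA2 : ∀ a ∈ A, ∀ b ∈ A, ∃ k, a ∈ (run k).G ∧ b ∈ (run k).G := by
    intro a ha b hb
    obtain ⟨i, hi⟩ := Set.mem_iUnion.mp ha
    obtain ⟨j, hj⟩ := Set.mem_iUnion.mp hb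
    exact ⟨max i j, hmono (le_max_left i j) hi, hmono (le_max_right i j) hj⟩
  have hsinj : ∀ a ∈ A, ∀ b ∈ A, sig a = sig b → a = b := by
    intro a ha b hb h
    obtain ⟨k, hak, hbk⟩ := hA2 a ha b hb
    exact (inv k).sig_inj a hak b hbk h
  let B : Set (Term n m × (Fin n →₀ ℕ)) :=
    {x | ∃ a ∈ A, sig a = x.1 ∧ ord.degree (bar f a) = x.2}
  have hAne : ∀ a ∈ A, a ≠ 0 := by
    intro a ha
    obtain ⟨k, hk⟩ := Set.mem_iUnion.mp ha
    exact ne_zero_of_bar_ne_zero ((inv k).bar_ne_zero a hk)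
  have hB : B.Finite := by
    refine finite_of_parents hord ?_ ?_ ?_
    · rintro ⟨u, p⟩ ⟨a, ha, hau, rfl⟩ ⟨v, q⟩ ⟨b, hb, hbv, rfl⟩ huv
      dsimp only at hau hbv huv
      obtain rfl := hsinj a ha b hb (by rw [hau, hbv, huv])
      rw [huv]
    · rintro ⟨u, p⟩ ⟨a, ha, hau, rfl⟩ ⟨v, q⟩ ⟨b, hb, hbv, rfl⟩ t t' h1 h2
      obtain ⟨k, hak, hbk⟩ := hA2 a ha b hb
      refine (inv k).shift_eq hord hrw hak hbk ?_ h2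
      dsimp only at hau hbv h1
      rw [hau, hbv, h1, shiftBot_coe]
    · rintro ⟨u, p⟩ ⟨a, ha, hau, rfl⟩
      obtain ⟨k, hk⟩ := Set.mem_iUnion.mp ha
      dsimp only at hau
      rcases (inv k).parents a hk with ⟨i, hi⟩ | ⟨g, hg, h, hh, hlt, hs, hd⟩
      · left
        rw [hau, sig_basisVec, WithBot.coe_inj] at hi
        exact ⟨i, hi⟩
      · right
        have hgA : g ∈ A := Set.mem_iUnion.mpr ⟨k, hg⟩
        have hhA : h ∈ A := Set.mem_iUnion.mpr ⟨k, hh⟩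
        obtain ⟨v, hv⟩ := exists_sig_eq (hAne g hgA)
        obtain ⟨w, hw⟩ := exists_sig_eq (hAne h hhA)
        refine ⟨(v, _), ⟨g, hgA, hv, rfl⟩, (w, _), ⟨h, hhA, hw, rfl⟩, ?_, ?_, hd⟩
        · rw [pairSig, pairSig, hv, hw, shiftBot_coe, shiftBot_coe, WithBot.coe_lt_coe] at hlt
          exact hlt
        · rw [pairSig, hau, hv, shiftBot_coe, WithBot.coe_inj] at hs
          exact hs
  refine Set.Finite.of_finite_image (f := sig) ?_ fun a ha b hb => hsinj a ha b hb
  refine (hB.image fun x => (x.1 : WithBot (Term n m))).subset ?_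
  rintro _ ⟨a, ha, rfl⟩
  obtain ⟨u, hu⟩ := exists_sig_eq (hAne a ha)
  exact ⟨(u, _), ⟨a, ha, hu, rfl⟩, hu.symm⟩

theorem not_exists_infinite_run (hord : IsCompatibleTermOrder (m := m) ord)
    (hrw : IsRewriteOrder ord f rw) :
    ¬ ∃ run : ℕ → RBState K n m, run 0 = initState f ∧
      ∀ k, RBStep ord f rw (run k) (run (k + 1)) := by
  rintro ⟨run, h0, hstep⟩
  have inv : ∀ k, RBInvariant ord f rw (run k) := by
    intro k
    induction k with
    | zero => exact h0 ▸ rbInvariant_initState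
    | succ k ih => exact ih.step hord hrw (hstep k)
  have hprog := fun k => (inv k).step_progress hord hrw (hstep k)
  have hmono : Monotone fun k => (run k).G := monotone_nat_of_le_succ fun k =>
    (hprog k).elim (fun h => h.1.ge) fun h => h.1
  have hfin := finite_iUnion_G hord hrw inv hmono
  set A := ⋃ k, (run k).G with hA
  have hcard : ∀ k, (run k).G.ncard ≤ A.ncard := fun k =>
    Set.ncard_le_ncard (Set.subset_iUnion (fun k => (run k).G) k) hfin
  -- The number of elements still to be found, then the size of `P`, decrease lexicographically.
  let μ : ℕ → ℕ ×ₗ ℕ := fun k => toLex (A.ncard - (run k).G.ncard, (run k).P.ncard)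
  obtain ⟨k, hk⟩ := WellFounded.not_rel_apply_succ (r := (· < ·)) μ
  refine hk (Prod.Lex.toLex_lt_toLex.mpr ?_)
  rcases hprog k with ⟨hG, hP⟩ | hG
  · exact .inr ⟨by rw [hG], Set.ncard_lt_ncard hP (inv k).finite_P⟩
  · have h1 := Set.ncard_lt_ncard hG (inv (k + 1)).finite_G
    have h2 := hcard (k + 1)
    exact .inl (by dsimp only; omega)

end Termination

/-! ### The output -/

section Output

variable {K : Type*} [Field K] {n m : ℕ} [LinearOrder (Term n m)] {ord : MonomialOrder (Fin n)}
  {f : Fin m → MvPolynomial (Fin n) K}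

theorem SRedZero.bar_mem_span {G : Set (FreeMod K n m)} {a : FreeMod K n m}
    (h : SRedZero ord f G a) : bar f a ∈ Ideal.span (bar f '' G) := by
  obtain ⟨b, hred, hb⟩ := h
  induction hred using Relation.ReflTransGen.head_induction_on with
  | refl => rw [hb]; exact zero_mem _
  | head hac _ ih => exact (Submodule.sub_mem_iff_left _ ih).mp hac.sub_mem_span

theorem IsSigGB.span_eq {G : Set (FreeMod K n m)} (h : IsSigGB ord f G) :
    Ideal.span (bar f '' G) = Ideal.span (Set.range f) := by
  apply le_antisymm
  · rw [Ideal.span_le]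
    rintro _ ⟨g, -, rfl⟩
    exact bar_mem_span_range g
  · rw [Ideal.span_le]
    rintro _ ⟨i, rfl⟩
    rw [← bar_basisVec (f := f) i]
    exact (h _ _ (sig_basisVec i)).bar_mem_span

end Output

end SigGB

theorem mainTheorem1 {K : Type*} [Field K] {n m : ℕ}
    (f : Fin m → MvPolynomial (Fin n) K)
    (ord : MonomialOrder (Fin n))
    [LinearOrder (SigGB.Term n m)] (hord : SigGB.IsCompatibleTermOrder (m := m) ord)
    (rw : SigGB.SigPolyPair f → SigGB.SigPolyPair f → Prop)
    (hrw : SigGB.IsRewriteOrder ord f rw) :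
    (¬ ∃ run : ℕ → SigGB.RBState K n m, run 0 = SigGB.initState f ∧
      ∀ k, SigGB.RBStep ord f rw (run k) (run (k + 1))) ∧
    (∀ s, SigGB.Reachable ord f rw s → s.P.Nonempty → ∃ s', SigGB.RBStep ord f rw s s') ∧
    (∀ s, SigGB.Reachable ord f rw s → s.P = ∅ →
      s.G.Finite ∧
      SigGB.IsRewriteBasis ord f rw s.G ∧
      SigGB.IsSigGB ord f s.G ∧
      Ideal.span (SigGB.bar f '' s.G) = Ideal.span (Set.range f)) := by
  refine ⟨SigGB.not_exists_infinite_run hord hrw, fun s hs hP =>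
    (SigGB.RBInvariant.of_reachable hord hrw hs).exists_step hP, fun s hs hP => ?_⟩
  have inv := SigGB.RBInvariant.of_reachable hord hrw hs
  have hRB : SigGB.IsRewriteBasis ord f rw s.G := fun u =>
    inv.isRewriteBasisIn hord hrw u fun p hp => absurd (hP ▸ hp) (Set.notMem_empty p)
  have hGB : SigGB.IsSigGB ord f s.G := fun u => (hRB u).isSigGBIn hord
    (SigGB.isSigGBUpTo_of_isRewriteBasisIn hord fun v _ => hRB v)
  exact ⟨inv.finite_G, hRB, hGB, hGB.span_eq⟩
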